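/- Let $m\ge 5$ be an odd integer, let $u\ge 1$ be an integer with $\gcd(u,m)=1$, and let $\mathrm{Tr}$ denote the absolute trace from $\mathbb{F}_{2^m}$ to $\mathbb{F}_2$. Let $\rho=0$ if $\frac{m^2-1}{8}$ is even and $\rho=1$ if $\frac{m^2-1}{8}$ is odd. Put $$D_\rho=\{x\in\mathbb{F}_{2^m} : \mathrm{Tr}(x)=1,\ \mathrm{Tr}(x^{2^u+1})=\rho\}=\{d_1,\dots,d_n\}$$ with $d_1,\dots,d_n$ distinct, and let $$\mathcal{C}_{D_\rho}=\{(\mathrm{Tr}(bd_1),\dots,\mathrm{Tr}(bd_n)) : b\in\mathbb{F}_{2^m}\}\subseteq\mathbb{F}_2^n .$$ For a binary linear code $\mathcal{C}$ of length $n$, let $\mathcal{C}^\perp$ be its dual with respect to the Euclidean inner product and $A_w(\mathcal{C})$ the number of its codewords of Hamming weight $w$. The codewords of weight $w$ in $\mathcal{C}$ are said to hold a $2$-$(v,w,\lambda)$ design if $A_w(\mathcal{C})\neq 0$, $n=v$, $2\le w\le v$, and every $2$-subset of $\{1,\dots,n\}$ is contained in exactly $\lambda$ members of the set of supports of the codewords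 of weight $w$ in $\mathcal{C}$. Then the following two assertions hold. (1) The codewords of weight $2^{m-3}-2^{\frac{m-3}{2}}$ in $\mathcal{C}_{D_\rho}$ hold a $$2\text{-}\left(2^{m-2}-2^{\frac{m-3}{2}},\ 2^{m-3}-2^{\frac{m-3}{2}},\ 2^{m-3}-2^{\frac{m-3}{2}}-1\right)$$ design, and the codewords of weight $2^{m-3}$ in $\mathcal{C}_{D_\rho}$ hold a $$2\text{-}\left(2^{m-2}-2^{\frac{m-3}{2}},\ 2^{m-3},\ 2^{\frac{m-3}{2}}\left(2^{\frac{m-3}{2}}+1\right)\right)$$ design. (2) For every $r=2,3,\dots,2^{m-3}-2^{\frac{m-5}{2}}$, $$A_{2r}(\mathcal{C}_{D_\rho}^\perp)=2^{-(m-1)}\left(\binom{2^{m-2}-2^{\frac{m-3}{2}}}{2r}+(2^{m-1}-1)\sum_{\substack{0\le i\le 2^{m-3}-2^{\frac{m-3}{2}}\\ 0\le j\le 2^{\frac{m-5}{2}}\\ i+j=r}}(-1)^i\binom{2^{m-3}-2^{\frac{m-3}{2}}}{i}\binom{2^{\frac{m-3}{2}}}{2j}\right),$$ and, provided $A_{2r}(\mathcal{C}_{D_\rho}^\perp)>0$,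 the codewords of weight $2r$ in $\mathcal{C}_{D_\rho}^\perp$ hold a $$2\text{-}\left(2^{m-2}-2^{\frac{m-3}{2}},\ 2r,\ \frac{2r(2r-1)\,A_{2r}(\mathcal{C}_{D_\rho}^\perp)}{\left(2^{m-2}-2^{\frac{m-3}{2}}\right)\left(2^{m-2}-2^{\frac{m-3}{2}}-1\right)}\right)$$ design (in particular the last parameter is an integer). -/

import Mathlib

/-- `(P, B)` is a (simple) `t`-`(v, k, l)` design: `P` is a set of `v` points, `B` is a set of
`k`-subsets of `P` (blocks), `1 ≤ t ≤ k ≤ v`, and every `t`-subset of `P` is contained in exactly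
`l` blocks. -/
def IsTDesign {P : Type*} [Fintype P] (B : Set (Finset P)) (t v k l : ℕ) : Prop :=
  Fintype.card P = v ∧ 1 ≤ t ∧ t ≤ k ∧ k ≤ v ∧ (∀ b ∈ B, b.card = k) ∧
    ∀ T : Finset P, T.card = t → {b ∈ B | T ⊆ b}.ncard = l

namespace BinaryCode

/-- The support of a binary vector. -/
def supp {n : ℕ} (c : Fin n → ZMod 2) : Finset (Fin n) :=
  Finset.univ.filter fun i => c i ≠ 0

/-- The dual code with respect to the Euclidean inner product. -/
def dual {n : ℕ} (C : Submodule (ZMod 2) (Fin n → ZMod 2)) :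
    Submodule (ZMod 2) (Fin n → ZMod 2) where
  carrier := {c' | ∀ c ∈ C, c' ⬝ᵥ c = 0}
  add_mem' := by
    intro a b ha hb c hc
    rw [add_dotProduct, ha c hc, hb c hc, add_zero]
  zero_mem' := by
    intro c _
    exact zero_dotProduct c
  smul_mem' := by
    intro x a ha c hc
    rw [smul_dotProduct, ha c hc, smul_zero]

/-- `A_w(C)`: the number of codewords of Hamming weight `w` in `C`. -/
noncomputable def weightCount {n : ℕ} (C : Submodule (ZMod 2) (Fin n → ZMod 2)) (w : ℕ) : ℕ :=
  {c : Fin n → ZMod 2 | c ∈ C ∧ hammingNorm c = w}.ncard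

/-- The set of supports of the codewords of Hamming weight `w` in `C`. -/
def supportBlocks {n : ℕ} (C : Submodule (ZMod 2) (Fin n → ZMod 2)) (w : ℕ) :
    Set (Finset (Fin n)) :=
  supp '' {c : Fin n → ZMod 2 | c ∈ C ∧ hammingNorm c = w}

/-- The codewords of weight `w` in `C` hold a `t`-`(v, w, l)` design: there are such codewords,
and their supports are the blocks of a `t`-`(v, w, l)` design on the set of coordinates. -/
def HoldsDesign {n : ℕ} (C : Submodule (ZMod 2) (Fin n → ZMod 2)) (t v w l : ℕ) : Prop :=
  weightCount C w ≠ 0 ∧ IsTDesign (supportBlocks C w) t v w l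

/-- The code `{ (Tr(b d₁), …, Tr(b dₙ)) | b ∈ F }` of a defining set enumerated as `d₁, …, dₙ`,
where `Tr` is the absolute trace from `F` to the field with two elements. -/
noncomputable def definingSetCode {F : Type*} [Field F] [Algebra (ZMod 2) F] {n : ℕ}
    (d : Fin n → F) : Submodule (ZMod 2) (Fin n → ZMod 2) :=
  LinearMap.range
    (LinearMap.pi fun i => (Algebra.trace (ZMod 2) F).comp (LinearMap.mulRight (ZMod 2) (d i)))

/-- Codewords are exactly the vectors `(Tr(b dᵢ))ᵢ`. -/
theorem mem_definingSetCode {F : Type*} [Field F] [Algebra (ZMod 2) F] {n : ℕ}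
    (d : Fin n → F) (c : Fin n → ZMod 2) :
    c ∈ definingSetCode d ↔ ∃ b : F, c = fun i => Algebra.trace (ZMod 2) F (b * d i) := by
  constructor
  · rintro ⟨b, rfl⟩
    exact ⟨b, rfl⟩
  · rintro ⟨b, rfl⟩
    exact ⟨b, rfl⟩

/-- The defining set `D_ρ = { x ∈ F | Tr(x) = 1, Tr(x^(2^u+1)) = ρ }`. -/
def definingSet (F : Type*) [Field F] [Algebra (ZMod 2) F] (u : ℕ) (ρ : ZMod 2) : Set F :=
  {x | Algebra.trace (ZMod 2) F x = 1 ∧ Algebra.trace (ZMod 2) F (x ^ (2 ^ u + 1)) = ρ}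

end BinaryCode

/-! Write χ for the sign character of 𝔽₂ and W(b) = ∑ χ(Tr(x^(2^u+1) + bx)). Expanding the indicator
of D_ρ in characters expresses the character sum of each codeword, hence its weight, through W(b) -
W(b+1). Everything therefore rests on two facts about W.

Absolute values: squaring W leaves a sum over the radical {0, 1} of the quadratic form
(`goldSum_sq`), so W(b) = 0 if Tr b = 0 and W(b) = ±2^((m+1)/2) if Tr b = 1. Exactly one of b, b+1
has trace 1, so every b other than 0, 1 gives one of two weights w₁ < w₂ with w₁ + w₂ = n.

One sign: the length needs W(1) itself (`goldSum_one`). In a self-dual normal basis ordered by x ↦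
x^(2^u) the form becomes ∑ (x_i x_{i+1} + x_i), so W(1) is the trace of the m-th power of a 2×2
transfer matrix with eigenvalues 1 ± i. Its sign is (-1)^((m²-1)/8) = χ(ρ), which gives n = 2^(m-2)
- 2^((m-3)/2).

The designs then follow from orthogonality alone, as recorded in `IsTwoWeightEncoding`. The code
contains the all-one word and its coordinate functionals are nonzero and distinct. This fixes the
first and second moments of coordinates over the words of weight w₁, so pair counts do not depend on
the pair. For the dual, a MacWilliams argument restricted to words nonzero at i and j gives an
enumerator depending only on the same moments (`card_mul_dualEnumerator_pair`); the Assmus–Mattson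
theorem is not used. -/

/-! ### Self-dual normal bases via the group ring -/

/-- The action of the group ring on a field through a group of automorphisms. -/
noncomputable def groupRingAction {H L : Type*} [Group H] [Field L] [Algebra (ZMod 2) L]
    (σ : H ≃* Gal(L/ZMod 2)) : MonoidAlgebra (ZMod 2) H →ₐ[ZMod 2] Module.End (ZMod 2) L :=
  MonoidAlgebra.lift (ZMod 2) (Module.End (ZMod 2) L) H
    ((AlgEquiv.toLinearMapHom (ZMod 2) L).comp σ.toMonoidHom)

theorem groupRingAction_single {H L : Type*} [Group H] [Field L] [Algebra (ZMod 2) L]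
    (σ : H ≃* Gal(L/ZMod 2)) (h : H) (r : ZMod 2) (y : L) :
    groupRingAction σ (MonoidAlgebra.single h r) y = r • σ h y := by
  simp [groupRingAction, MonoidAlgebra.lift_single]

theorem trace_apply_algEquiv {L : Type*} [Field L] [Algebra (ZMod 2) L]
    (g : Gal(L/ZMod 2)) (y : L) :
    Algebra.trace (ZMod 2) L (g y) = Algebra.trace (ZMod 2) L y :=
  Algebra.trace_eq_of_algEquiv g y

/-- Automorphisms preserve the trace, so the adjoint of h for the trace form is h⁻¹. -/
theorem trace_mul_groupRingAction {H L : Type*} [CommGroup H] [Field L] [Algebra (ZMod 2) L]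
    (σ : H ≃* Gal(L/ZMod 2)) (a : MonoidAlgebra (ZMod 2) H) (y z : L) :
    Algebra.trace (ZMod 2) L (groupRingAction σ a y * z) =
      Algebra.trace (ZMod 2) L
        (y * groupRingAction σ (MonoidAlgebra.mapDomainRingHom (ZMod 2) (invMonoidHom : H →* H) a) z) := by
  induction a using MonoidAlgebra.induction_linear with
  | zero => simp
  | add a b ha hb => simp only [map_add, LinearMap.add_apply, add_mul, mul_add, ha, hb]
  | single h r =>
    have : Algebra.trace (ZMod 2) L (σ h y * z) = Algebra.trace (ZMod 2) L (y * σ h⁻¹ z) := by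
      rw [← trace_apply_algEquiv (σ h) (y * _)]
      simp [map_mul]
    simp [groupRingAction_single, this]

/-- The Gram element of `y`: the coefficient at `h` is `Tr (y * h y)`. -/
noncomputable def gramElement {H L : Type*} [Group H] [Fintype H] [Field L] [Algebra (ZMod 2) L]
    (σ : H ≃* Gal(L/ZMod 2)) (y : L) : MonoidAlgebra (ZMod 2) H :=
  MonoidAlgebra.ofCoeff (Finsupp.equivFunOnFinite.symm fun h =>
    Algebra.trace (ZMod 2) L (y * σ h y))

theorem coeff_gramElement {H L : Type*} [Group H] [Fintype H] [Field L] [Algebra (ZMod 2) L]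
    (σ : H ≃* Gal(L/ZMod 2)) (y : L) (h : H) :
    (gramElement σ y).coeff h = Algebra.trace (ZMod 2) L (y * σ h y) := rfl

theorem trace_mul_inv_algEquiv {H L : Type*} [Group H] [Field L] [Algebra (ZMod 2) L]
    (σ : H ≃* Gal(L/ZMod 2)) (y : L) (h : H) :
    Algebra.trace (ZMod 2) L (y * σ h⁻¹ y) = Algebra.trace (ZMod 2) L (y * σ h y) := by
  rw [← trace_apply_algEquiv (σ h)]
  simp [map_mul, mul_comm]

theorem mapDomain_inv_gramElement {H L : Type*} [CommGroup H] [Fintype H] [Field L]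
    [Algebra (ZMod 2) L] (σ : H ≃* Gal(L/ZMod 2)) (y : L) :
    MonoidAlgebra.mapDomainRingHom (ZMod 2) (invMonoidHom : H →* H) (gramElement σ y) =
      gramElement σ y := by
  ext h
  have h1 := Finsupp.mapDomain_apply (inv_injective (G := H)) (gramElement σ y).coeff h⁻¹
  rw [inv_inv, coeff_gramElement, trace_mul_inv_algEquiv] at h1
  exact h1

/-- Turns trace pairings of conjugates of y into multiplication by the Gram element; on a group
element this is the symmetry Tr(y·hy) = Tr(y·h⁻¹y). -/
theorem trace_mul_action_eq_coeff {H L : Type*} [CommGroup H] [Fintype H] [Field L]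
    [Algebra (ZMod 2) L] (σ : H ≃* Gal(L/ZMod 2)) (y : L) (c : MonoidAlgebra (ZMod 2) H) :
    Algebra.trace (ZMod 2) L (y * groupRingAction σ c y) = (c * gramElement σ y).coeff 1 := by
  induction c using MonoidAlgebra.induction_linear with
  | zero => simp
  | add a b ha hb => simp [add_mul, mul_add, ha, hb]
  | single h r =>
    rw [MonoidAlgebra.coeff_single_mul_apply, coeff_gramElement, mul_one, trace_mul_inv_algEquiv,
      groupRingAction_single]
    simp

theorem groupRingAction_eq_sum {H L : Type*} [Group H] [Fintype H] [Field L] [Algebra (ZMod 2) L]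
    (σ : H ≃* Gal(L/ZMod 2)) (c : MonoidAlgebra (ZMod 2) H) (y : L) :
    groupRingAction σ c y = ∑ h, c.coeff h • σ h y := by
  induction c using MonoidAlgebra.induction_linear with
  | zero => simp
  | add a b ha hb => simp [add_smul, ha, hb, Finset.sum_add_distrib]
  | single h r =>
    classical
    rw [groupRingAction_single, Finset.sum_eq_single h]
    · simp
    · intro b _ hb
      simp [MonoidAlgebra.coeff_single, hb.symm]
    · simp

/-- In a finite ring it suffices that c · t = 0 forces c = 0. Such a c makes cy orthogonal to every
conjugate of y, so cy = 0 because the conjugates span, and c = 0 because they are independent. -/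
theorem isUnit_gramElement {H L : Type*} [CommGroup H] [Fintype H] [Field L] [Finite L]
    [Algebra (ZMod 2) L] (σ : H ≃* Gal(L/ZMod 2)) (y : L)
    (hy : LinearIndependent (ZMod 2) fun g : Gal(L/ZMod 2) => g y)
    (hspan : ⊤ ≤ Submodule.span (ZMod 2) (Set.range fun g : Gal(L/ZMod 2) => g y)) :
    IsUnit (gramElement σ y) := by
  have : Finite (MonoidAlgebra (ZMod 2) H) :=
    Finite.of_equiv (H → ZMod 2) (MonoidAlgebra.coeffEquiv.trans Finsupp.equivFunOnFinite).symm
  rw [isUnit_iff_mem_nonZeroDivisors_of_finite, mem_nonZeroDivisors_iff_right]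
  intro c hc
  have h0 : groupRingAction σ c y = 0 := by
    apply (traceForm_nondegenerate (ZMod 2) L).1
    intro z
    rw [Algebra.traceForm_apply]
    have hz := hspan (Submodule.mem_top (x := z))
    induction hz using Submodule.span_induction with
    | mem z hz =>
      obtain ⟨g, rfl⟩ := hz
      obtain ⟨h, rfl⟩ := σ.surjective g
      have h2 : groupRingAction σ (MonoidAlgebra.single h⁻¹ 1 * c) y
          = σ h⁻¹ (groupRingAction σ c y) := by
        rw [map_mul, Module.End.mul_apply, groupRingAction_single, one_smul]
      have h1 := trace_mul_action_eq_coeff σ y (MonoidAlgebra.single h⁻¹ 1 * c)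
      rw [mul_assoc, hc, mul_zero, h2, ← trace_apply_algEquiv (σ h), map_mul] at h1
      simpa [mul_comm] using h1
    | zero => simp
    | add a b _ _ ha hb => simp [mul_add, ha, hb]
    | smul r a _ ha => simp [ha]
  rw [groupRingAction_eq_sum] at h0
  have h1 := Fintype.linearIndependent_iff.1 (hy.comp σ σ.injective) (fun h => c.coeff h) h0
  ext h
  simpa using h1 h

/-- Raising to a power of 2 is additive in characteristic 2, and 2^φ(|H|) ≡ 1 modulo |H| by Euler,
so every group element is fixed. -/
theorem groupRing_pow_two_pow_totient {H : Type*} [CommGroup H] [Fintype H]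
    (hodd : Odd (Fintype.card H)) (c : MonoidAlgebra (ZMod 2) H) :
    c ^ 2 ^ (Fintype.card H).totient = c := by
  have : CharP (MonoidAlgebra (ZMod 2) H) 2 := charP_of_injective_algebraMap
    (algebraMap (ZMod 2) (MonoidAlgebra (ZMod 2) H)).injective 2
  induction c using MonoidAlgebra.induction_linear with
  | zero => simp
  | add a b ha hb => rw [add_pow_char_pow, ha, hb]
  | single h r =>
    rw [MonoidAlgebra.single_pow]
    congr 1
    · have h1 : 2 ^ (Fintype.card H).totient ≡ 1 [MOD Fintype.card H] :=
        Nat.ModEq.pow_totient (Nat.coprime_two_left.2 hodd)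
      conv_rhs => rw [← pow_one h]
      rw [pow_eq_pow_iff_modEq]
      exact h1.of_dvd (orderOf_dvd_card)
    · exact ZMod.pow_card_pow r

/-- Self-dual normal bases exist in odd degree over the field with two elements. -/
theorem exists_selfDual_normal {H L : Type*} [CommGroup H] [Fintype H] [DecidableEq H] [Field L]
    [Finite L] [Algebra (ZMod 2) L] (σ : H ≃* Gal(L/ZMod 2)) (hodd : Odd (Fintype.card H)) :
    ∃ α : L, ∀ h, Algebra.trace (ZMod 2) L (α * σ h α) = if h = 1 then 1 else 0 := by
  obtain ⟨y, hy, hspan⟩ : ∃ y : L, LinearIndependent (ZMod 2) (fun g : Gal(L/ZMod 2) => g y) ∧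
      ⊤ ≤ Submodule.span (ZMod 2) (Set.range fun g : Gal(L/ZMod 2) => g y) := by
    have h : (fun g : Gal(L/ZMod 2) => g (IsGalois.normalBasis (ZMod 2) L 1)) =
        IsGalois.normalBasis (ZMod 2) L := by
      funext g
      exact (IsGalois.normalBasis_apply g).symm
    refine ⟨IsGalois.normalBasis (ZMod 2) L 1, ?_, ?_⟩
    · rw [h]
      exact Module.Basis.linearIndependent _
    · rw [h]
      exact (Module.Basis.span_eq _).ge
  set t := gramElement σ y with ht
  -- Replacing y by cy multiplies the Gram element by c and its image under inversion. Since
  -- t^(2q+2) = t with t a unit and fixed by inversion, c = t^q normalises it to 1.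
  obtain ⟨q, hq⟩ : ∃ q, 2 ^ (Fintype.card H).totient = 2 * q + 2 := by
    have h0 : 0 < (Fintype.card H).totient := Nat.totient_pos.2 Fintype.card_pos
    obtain ⟨k, hk⟩ := Nat.exists_eq_succ_of_ne_zero h0.ne'
    have := Nat.one_le_two_pow (n := k)
    exact ⟨2 ^ k - 1, by rw [hk, pow_succ]; omega⟩
  have hone : t ^ q * t ^ q * t = 1 := by
    have h1 := groupRing_pow_two_pow_totient hodd t
    rw [hq] at h1
    apply (isUnit_gramElement σ y hy hspan).mul_left_cancel
    rw [mul_one, ← ht]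
    nth_rewrite 5 [← h1]
    ring
  have hsymm : MonoidAlgebra.mapDomainRingHom (ZMod 2) (invMonoidHom : H →* H) (t ^ q) = t ^ q := by
    rw [map_pow, mapDomain_inv_gramElement]
  refine ⟨groupRingAction σ (t ^ q) y, fun h => ?_⟩
  have h1 : σ h (groupRingAction σ (t ^ q) y) =
      groupRingAction σ (MonoidAlgebra.single h 1 * t ^ q) y := by
    rw [map_mul, Module.End.mul_apply, groupRingAction_single, one_smul]
  rw [h1, trace_mul_groupRingAction, hsymm, ← Module.End.mul_apply, ← map_mul,
    trace_mul_action_eq_coeff, ← ht]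
  have h2 : t ^ q * (MonoidAlgebra.single h 1 * t ^ q) * t = MonoidAlgebra.single h 1 := by
    calc _ = MonoidAlgebra.single h 1 * (t ^ q * t ^ q * t) := by ring
      _ = _ := by rw [hone, mul_one]
  rw [h2, MonoidAlgebra.coeff_single, Finsupp.single_apply]

/-! ### The sign character of 𝔽₂ -/

/-- The nontrivial sign character of the field with two elements. -/
def bitSign (a : ZMod 2) : ℤ := if a = 0 then 1 else -1

theorem bitSign_zero : bitSign 0 = 1 := rfl

theorem bitSign_one : bitSign 1 = -1 := rfl

theorem bitSign_add (a b : ZMod 2) : bitSign (a + b) = bitSign a * bitSign b := by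
  revert a b; decide

theorem bitSign_mul_self (a : ZMod 2) : bitSign a * bitSign a = 1 := by
  revert a; decide

theorem bitSign_sum {ι : Type*} (s : Finset ι) (f : ι → ZMod 2) :
    bitSign (∑ i ∈ s, f i) = ∏ i ∈ s, bitSign (f i) := by
  classical
  induction s using Finset.induction_on with
  | empty => rfl
  | insert a s ha ih => rw [Finset.sum_insert ha, Finset.prod_insert ha, bitSign_add, ih]

/-- Translation by a point where f is 1 negates the sum. -/
theorem sum_bitSign_addMonoidHom {A : Type*} [AddCommGroup A] [Fintype A] (f : A →+ ZMod 2)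
    (hf : ∃ a, f a ≠ 0) : ∑ a, bitSign (f a) = 0 := by
  obtain ⟨a, ha⟩ := hf
  have ha1 : f a = 1 := by
    generalize f a = z at ha
    revert z; decide
  have h : ∑ x, bitSign (f x) = ∑ x, bitSign (f (x + a)) :=
    (Equiv.sum_comp (Equiv.addRight a) fun x => bitSign (f x)).symm
  simp only [map_add, ha1, bitSign_add, bitSign_one] at h
  rw [← Finset.sum_mul] at h
  linarith

/-! ### Transfer matrices and closed walks -/

theorem Matrix.pow_apply_eq_sum_paths {ι R : Type*} [Fintype ι] [DecidableEq ι] [CommRing R]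
    (M : Matrix ι ι R) (k : ℕ) (a b : ι) :
    (M ^ k) a b = ∑ x : Fin (k + 1) → ι, if x 0 = a ∧ x (Fin.last k) = b then
      ∏ i : Fin k, M (x i.castSucc) (x i.succ) else 0 := by
  induction k generalizing a with
  | zero =>
    rw [pow_zero, ← Equiv.sum_comp (Equiv.funUnique (Fin 1) ι).symm]
    simp only [Finset.univ_eq_empty, Finset.prod_empty]
    rw [Matrix.one_apply]
    simp only [Equiv.funUnique_symm_apply, uniqueElim_const]
    by_cases h : a = b
    · subst h; simp
    · rw [if_neg h]
      refine (Finset.sum_eq_zero fun x _ => if_neg ?_).symm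
      rintro ⟨rfl, rfl⟩
      exact h rfl
  | succ k ih =>
    rw [pow_succ', Matrix.mul_apply, ← Equiv.sum_comp (Fin.consEquiv fun _ : Fin (k + 2) => ι),
      Fintype.sum_prod_type]
    simp only [Fin.consEquiv_apply, Fin.cons_zero, Fin.prod_univ_succ, ← Fin.succ_last,
      Fin.cons_succ, Fin.castSucc_zero, ← Fin.succ_castSucc]
    symm
    rw [Finset.sum_eq_single a]
    · simp only [ih, Finset.mul_sum]
      rw [Finset.sum_comm]
      refine Finset.sum_congr rfl fun x _ => ?_
      symm
      rw [Finset.sum_eq_single (x 0)]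
      · by_cases h : x (Fin.last k) = b <;> simp [h]
      · intro c _ hc
        rw [if_neg (fun h => hc h.1.symm), mul_zero]
      · simp
    · intro c _ hc
      refine Finset.sum_eq_zero fun x _ => if_neg ?_
      rintro ⟨h, -⟩
      exact hc h
    · simp

/-- The index `i + 1` wraps around in `Fin (k + 1)`, which closes the walk. -/
theorem Matrix.trace_pow_eq_sum_cycles {ι R : Type*} [Fintype ι] [DecidableEq ι] [CommRing R]
    (M : Matrix ι ι R) (k : ℕ) :
    (M ^ (k + 1)).trace = ∑ x : Fin (k + 1) → ι, ∏ i : Fin (k + 1), M (x i) (x (i + 1)) := by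
  have h1 : (M ^ (k + 1)).trace = ∑ a, ∑ b, (M ^ k) a b * M b a := by
    simp only [Matrix.trace, Matrix.diag_apply, pow_succ, Matrix.mul_apply]
  simp only [h1, Matrix.pow_apply_eq_sum_paths, Finset.sum_mul]
  rw [Finset.sum_congr rfl fun a _ => Finset.sum_comm, Finset.sum_comm]
  refine Finset.sum_congr rfl fun x _ => ?_
  rw [Finset.sum_eq_single (x 0), Finset.sum_eq_single (x (Fin.last k))]
  · rw [if_pos ⟨rfl, rfl⟩, Fin.prod_univ_castSucc, Fin.last_add_one]
    simp only [Fin.coeSucc_eq_succ]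
  · intro b _ hb
    rw [if_neg fun h => hb h.2.symm, zero_mul]
  · simp
  · intro b _ hb
    exact Finset.sum_eq_zero fun c _ => by rw [if_neg fun h => hb h.1.symm, zero_mul]
  · simp

/-- The transfer matrix of the cyclic quadratic form `∑ (x_i x_{i+1} + x_i)`. -/
def transferMatrix : Matrix (ZMod 2) (ZMod 2) ℤ :=
  Matrix.of fun a b => bitSign (a * b + a)

/-- The matrix is √2 times a rotation by an eighth of a turn, so only m modulo 8 matters for the
sign. -/
theorem transferMatrix_pow_eight : transferMatrix ^ 8 = (16 : ℤ) • (1 : Matrix _ _ ℤ) := by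
  decide +kernel

theorem trace_transferMatrix_pow (m : ℕ) (hodd : Odd m) (ε : ℤ)
    (hε : (Even ((m ^ 2 - 1) / 8) ∧ ε = 1) ∨ (Odd ((m ^ 2 - 1) / 8) ∧ ε = -1)) :
    (transferMatrix ^ m).trace = ε * 2 ^ ((m + 1) / 2) := by
  obtain ⟨q, r, hr, rfl⟩ : ∃ q r, r < 8 ∧ m = 8 * q + r :=
    ⟨m / 8, m % 8, Nat.mod_lt _ (by norm_num), (Nat.div_add_mod m 8).symm⟩
  have hpow : transferMatrix ^ (8 * q + r) = (16 : ℤ) ^ q • transferMatrix ^ r := by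
    rw [pow_add, pow_mul, transferMatrix_pow_eight, smul_pow, one_pow, smul_mul_assoc, one_mul]
  rw [hpow, Matrix.trace_smul, smul_eq_mul]
  have h16 : (16 : ℤ) ^ q = 2 ^ (4 * q) := by rw [pow_mul]; norm_num
  rw [h16]
  -- Here d is the parity of (m² - 1)/8, which determines ε.
  have key (c d : ℕ) (hc : (8 * q + r) ^ 2 = 8 * (2 * c + d) + 1) (s : ℤ)
      (hs : (d = 0 ∧ s = 1) ∨ (d = 1 ∧ s = -1)) : ε = s := by
    rw [hc, Nat.add_sub_cancel, Nat.mul_div_cancel_left _ (by norm_num)] at hε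
    rcases hs with ⟨rfl, rfl⟩ | ⟨rfl, rfl⟩ <;> rcases hε with ⟨h, rfl⟩ | ⟨h, rfl⟩
    · rfl
    · exact absurd h (by simp)
    · exact absurd h (by simp)
    · rfl
  have hsplit (e : ℕ) (h : (8 * q + r + 1) / 2 = 4 * q + e) :
      (2 : ℤ) ^ ((8 * q + r + 1) / 2) = 2 ^ (4 * q) * 2 ^ e := by rw [h, pow_add]
  interval_cases r
  · exact absurd hodd (by rw [Nat.odd_iff]; omega)
  · rw [key (4 * q ^ 2 + q) 0 (by ring) 1 (by simp),
      hsplit 1 (by omega), show (transferMatrix ^ 1).trace = 2 by decide +kernel]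
    ring
  · exact absurd hodd (by rw [Nat.odd_iff]; omega)
  · rw [key (4 * q ^ 2 + 3 * q) 1 (by ring) (-1) (by simp),
      hsplit 2 (by omega), show (transferMatrix ^ 3).trace = -4 by decide +kernel]
    ring
  · exact absurd hodd (by rw [Nat.odd_iff]; omega)
  · rw [key (4 * q ^ 2 + 5 * q + 1) 1 (by ring) (-1) (by simp),
      hsplit 3 (by omega), show (transferMatrix ^ 5).trace = -8 by decide +kernel]
    ring
  · exact absurd hodd (by rw [Nat.odd_iff]; omega)
  · rw [key (4 * q ^ 2 + 7 * q + 3) 0 (by ring) 1 (by simp),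
      hsplit 4 (by omega), show (transferMatrix ^ 7).trace = 16 by decide +kernel]
    ring

/-! ### The Walsh transform of the Gold function -/

section GoldSum

variable {F : Type*} [Field F] [Fintype F] [Algebra (ZMod 2) F]

/-- The Walsh transform of the Gold function `x ↦ Tr (x ^ (2 ^ u + 1))`. -/
noncomputable def goldSum (F : Type*) [Field F] [Fintype F] [Algebra (ZMod 2) F] (u : ℕ) (b : F) :
    ℤ :=
  ∑ x : F, bitSign (Algebra.trace (ZMod 2) F (x ^ (2 ^ u + 1) + b * x))

theorem charP_two_of_algebra (F : Type*) [Field F] [Algebra (ZMod 2) F] : CharP F 2 :=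
  charP_of_injective_algebraMap (algebraMap (ZMod 2) F).injective 2

theorem finrank_eq_of_card {m : ℕ} (hF : Fintype.card F = 2 ^ m) :
    Module.finrank (ZMod 2) F = m := by
  have h := Module.card_eq_pow_finrank (K := ZMod 2) (V := F)
  rw [hF, ZMod.card] at h
  exact (Nat.pow_right_injective le_rfl h).symm

theorem orderOf_frobenius_of_card {m : ℕ} (hF : Fintype.card F = 2 ^ m) :
    orderOf (FiniteField.frobeniusAlgEquivOfAlgebraic (ZMod 2) F) = m := by
  rw [FiniteField.orderOf_frobeniusAlgEquivOfAlgebraic, finrank_eq_of_card hF]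

theorem frobenius_pow_apply (u : ℕ) (x : F) :
    (FiniteField.frobeniusAlgEquivOfAlgebraic (ZMod 2) F ^ u) x = x ^ 2 ^ u := by
  rw [AlgEquiv.coe_pow, FiniteField.coe_frobeniusAlgEquivOfAlgebraic_iterate, ZMod.card]

theorem trace_one_of_card {m : ℕ} (hodd : Odd m) (hF : Fintype.card F = 2 ^ m) :
    Algebra.trace (ZMod 2) F 1 = 1 := by
  rw [← map_one (algebraMap (ZMod 2) F), Algebra.trace_algebraMap, finrank_eq_of_card hF, nsmul_one]
  exact ZMod.natCast_eq_one_iff_odd.2 hodd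

theorem trace_nondegenerate (a : F) (h : ∀ x, Algebra.trace (ZMod 2) F (a * x) = 0) : a = 0 :=
  (traceForm_nondegenerate (ZMod 2) F).1 a h

theorem sum_bitSign_trace {a : F} (ha : a ≠ 0) :
    ∑ x, bitSign (Algebra.trace (ZMod 2) F (a * x)) = 0 := by
  refine sum_bitSign_addMonoidHom
    ((Algebra.trace (ZMod 2) F).toAddMonoidHom.comp (AddMonoidHom.mulLeft a)) ?_
  by_contra! h
  exact ha (trace_nondegenerate a h)

/-- The radical of the Gold quadratic form. -/
theorem eq_zero_or_one_of_gold_radical {m u : ℕ} (hm : 1 < m) (hodd : Odd m)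
    (hF : Fintype.card F = 2 ^ m) (hum : Nat.gcd u m = 1) (z : F)
    (hz : ∀ x, Algebra.trace (ZMod 2) F (x ^ 2 ^ u * z + z ^ 2 ^ u * x) = 0) :
    z = 0 ∨ z = 1 := by
  have := charP_two_of_algebra F
  set g := FiniteField.frobeniusAlgEquivOfAlgebraic (ZMod 2) F with hg
  -- Moving the power 2^u off x makes the bilinear form Tr((g⁻ᵘz + gᵘz)x), and the trace form is
  -- nondegenerate.
  have h1 : (g ^ u)⁻¹ z + (g ^ u) z = 0 := by
    refine trace_nondegenerate _ fun x => ?_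
    rw [← hz x, map_add, add_mul, map_add, ← frobenius_pow_apply u x, ← frobenius_pow_apply u z,
      ← trace_apply_algEquiv (g ^ u) ((g ^ u)⁻¹ z * x), map_mul, ← AlgEquiv.mul_apply,
      mul_inv_cancel, AlgEquiv.one_apply, mul_comm z]
  have h2 : (g ^ (2 * u)) z = z := by
    have h3 := CharTwo.add_eq_zero.1 h1
    have h4 := congrArg (g ^ u) h3
    rw [← AlgEquiv.mul_apply, mul_inv_cancel, AlgEquiv.one_apply, ← AlgEquiv.mul_apply,
      ← pow_add, ← two_mul] at h4
    exact h4.symm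
  -- Since m is odd, g^(2u) also generates the Galois group, so z is fixed by g and lies in 𝔽₂.
  have hcop : Nat.Coprime (2 * u) m :=
    Nat.Coprime.mul_left (Nat.coprime_two_left.2 hodd) hum
  obtain ⟨k, hk⟩ := Nat.exists_mul_mod_eq_one_of_coprime hcop hm
  have h3 : ∀ j : ℕ, (g ^ (2 * u * j)) z = z := by
    intro j
    induction j with
    | zero => simp
    | succ j ih => rw [mul_add, mul_one, pow_add, AlgEquiv.mul_apply, h2, ih]
  have h4 : g z = z := by
    have h5 := h3 k
    rwa [← pow_mod_orderOf, orderOf_frobenius_of_card hF, hk.2, pow_one] at h5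
  have h5 : z ^ 2 = z := by
    have := frobenius_pow_apply 1 z
    rw [pow_one, pow_one] at this
    rw [← this]
    exact h4
  have h6 : z * (z - 1) = 0 := by rw [mul_sub, ← sq, h5, mul_one, sub_self]
  rcases mul_eq_zero.1 h6 with h | h
  · exact Or.inl h
  · exact Or.inr (sub_eq_zero.1 h)

/-- With y = x + z, the product of the terms at x and y is the term at z times a character linear in
x. Summing over x leaves only z in the radical: z = 0 contributes 2^m, and z = 1 contributes -2^m
χ(Tr b) because Tr 1 = 1 in odd degree. -/
theorem goldSum_sq {m u : ℕ} (hm : 1 < m) (hodd : Odd m)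
    (hF : Fintype.card F = 2 ^ m) (hum : Nat.gcd u m = 1) (b : F) :
    goldSum F u b ^ 2 = 2 ^ m * (1 - bitSign (Algebra.trace (ZMod 2) F b)) := by
  classical
  have := charP_two_of_algebra F
  have hshift (x z : F) : bitSign (Algebra.trace (ZMod 2) F (x ^ (2 ^ u + 1) + b * x)) *
      bitSign (Algebra.trace (ZMod 2) F ((x + z) ^ (2 ^ u + 1) + b * (x + z))) =
      bitSign (Algebra.trace (ZMod 2) F (z ^ (2 ^ u + 1) + b * z)) *
        bitSign (Algebra.trace (ZMod 2) F (x ^ 2 ^ u * z + z ^ 2 ^ u * x)) := by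
    rw [← bitSign_add, ← bitSign_add, ← map_add, ← map_add]
    congr 2
    rw [pow_succ (x + z), add_pow_char_pow, pow_succ x, pow_succ z, ← sub_eq_zero]
    ring_nf
    simp [CharTwo.two_eq_zero]
  have h1 : goldSum F u b ^ 2 = ∑ z : F,
      bitSign (Algebra.trace (ZMod 2) F (z ^ (2 ^ u + 1) + b * z)) *
        ∑ x : F, bitSign (Algebra.trace (ZMod 2) F (x ^ 2 ^ u * z + z ^ 2 ^ u * x)) := by
    have h2 : goldSum F u b ^ 2 = ∑ x : F, ∑ z : F,
        bitSign (Algebra.trace (ZMod 2) F (x ^ (2 ^ u + 1) + b * x)) *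
        bitSign (Algebra.trace (ZMod 2) F ((x + z) ^ (2 ^ u + 1) + b * (x + z))) := by
      rw [sq]
      conv_lhs => rw [goldSum, Finset.sum_mul]
      refine Finset.sum_congr rfl fun x _ => ?_
      rw [← Finset.mul_sum]
      congr 1
      exact (Equiv.sum_comp (Equiv.addLeft x) fun y =>
        bitSign (Algebra.trace (ZMod 2) F (y ^ (2 ^ u + 1) + b * y))).symm
    rw [h2, Finset.sum_comm]
    refine Finset.sum_congr rfl fun z _ => ?_
    rw [Finset.mul_sum]
    exact Finset.sum_congr rfl fun x _ => hshift x z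
  have hlin (z : F) (hz : z ≠ 0 ∧ z ≠ 1) :
      ∑ x : F, bitSign (Algebra.trace (ZMod 2) F (x ^ 2 ^ u * z + z ^ 2 ^ u * x)) = 0 := by
    refine sum_bitSign_addMonoidHom ((Algebra.trace (ZMod 2) F).toAddMonoidHom.comp
      { toFun := fun x => x ^ 2 ^ u * z + z ^ 2 ^ u * x
        map_zero' := by simp
        map_add' := fun x y => by rw [add_pow_char_pow]; ring }) ?_
    by_contra! h
    rcases eq_zero_or_one_of_gold_radical hm hodd hF hum z h with h | h
    · exact hz.1 h
    · exact hz.2 h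
  have htr1 (x : F) : Algebra.trace (ZMod 2) F (x ^ 2 ^ u) = Algebra.trace (ZMod 2) F x := by
    rw [← frobenius_pow_apply, trace_apply_algEquiv]
  rw [h1, Finset.sum_eq_add_of_mem (0 : F) 1 (Finset.mem_univ _) (Finset.mem_univ _) zero_ne_one]
  · simp only [mul_one, one_pow, one_mul, map_add, htr1, mul_zero, zero_add,
      add_zero, CharTwo.add_self_eq_zero, bitSign_zero, bitSign_add, bitSign_one,
      trace_one_of_card hodd hF, Finset.sum_const, Finset.card_univ, hF]
    simp [bitSign_zero, hF]
    ring
  · intro c _ hc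
    rw [hlin c hc, mul_zero]

/-- As gcd(u, m) = 1, x ↦ x^(2^u) generates the Galois group. In a self-dual normal basis it is a
cyclic shift of coordinates, so the summand is a product of transfer matrix entries around a cycle.
-/
theorem goldSum_one {m u : ℕ} (hodd : Odd m)
    (hF : Fintype.card F = 2 ^ m) (hum : Nat.gcd u m = 1) :
    goldSum F u 1 = (transferMatrix ^ m).trace := by
  set g := FiniteField.frobeniusAlgEquivOfAlgebraic (ZMod 2) F with hg
  obtain ⟨k, rfl⟩ : ∃ k, m = k + 1 := ⟨m - 1, by have := hodd.pos; omega⟩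
  have hcard : Nat.card Gal(F/ZMod 2) = k + 1 := by
    rw [IsGalois.card_aut_eq_finrank, finrank_eq_of_card hF]
  have horder : orderOf (g ^ u) = k + 1 := by
    rw [orderOf_pow, orderOf_frobenius_of_card hF, Nat.gcd_comm, hum, Nat.div_one]
  have hgen : ∀ x, x ∈ Subgroup.zpowers (g ^ u) := by
    have : Subgroup.zpowers (g ^ u) = ⊤ := by
      rw [← Subgroup.card_eq_iff_eq_top, Nat.card_zpowers, horder, hcard]
    simp [this]
  let σ : Multiplicative (ZMod (k + 1)) ≃* Gal(F/ZMod 2) := zmodMulEquivOfGenerator hgen hcard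
  have hσ : σ (Multiplicative.ofAdd 1) = g ^ u := zmodMulEquivOfGenerator_apply_ofAdd_one hgen hcard
  obtain ⟨α, hα⟩ := exists_selfDual_normal σ (by simpa using hodd)
  let a' : ZMod (k + 1) → F := fun i => σ (Multiplicative.ofAdd i) α
  have hshift' (i : ZMod (k + 1)) : a' i ^ 2 ^ u = a' (i + 1) := by
    rw [← frobenius_pow_apply, ← hg, ← hσ, ← AlgEquiv.mul_apply, ← map_mul, ← ofAdd_add, add_comm 1 i]
  have horth' (i j : ZMod (k + 1)) :
      Algebra.trace (ZMod 2) F (a' i * a' j) = if i = j then 1 else 0 := by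
    have h := hα ((Multiplicative.ofAdd i)⁻¹ * Multiplicative.ofAdd j)
    rw [← trace_apply_algEquiv (σ (Multiplicative.ofAdd i)), map_mul (σ (Multiplicative.ofAdd i)),
      ← AlgEquiv.mul_apply, ← map_mul σ, mul_inv_cancel_left] at h
    exact h.trans (if_congr inv_mul_eq_one rfl rfl)
  -- `ZMod (k + 1)` is `Fin (k + 1)` by definition, so the cyclic indices agree with those of the
  -- closed walks.
  let a : Fin (k + 1) → F := fun i => a' i
  have hshift (i : Fin (k + 1)) : a i ^ 2 ^ u = a (i + 1) := hshift' i
  have horth (i j : Fin (k + 1)) :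
      Algebra.trace (ZMod 2) F (a i * a j) = if i = j then 1 else 0 :=
    horth' i j
  -- Tr(a_i) = Tr(a_i²), which is 1 by self-duality.
  have htr (i : Fin (k + 1)) : Algebra.trace (ZMod 2) F (a i) = 1 := by
    have h := horth i i
    rw [if_pos rfl, ← sq] at h
    have h1 := frobenius_pow_apply 1 (a i)
    rw [pow_one 2] at h1
    rw [← h, ← h1]
    exact (trace_apply_algEquiv _ _).symm
  let φ : (Fin (k + 1) → ZMod 2) → F := fun x => ∑ i, x i • a i
  have hφj (x : Fin (k + 1) → ZMod 2) (j : Fin (k + 1)) :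
      Algebra.trace (ZMod 2) F (φ x * a j) = x j := by
    simp [φ, Finset.sum_mul, horth]
  have hinj : Function.Injective φ := fun x y h => by
    funext j
    rw [← hφj x, ← hφj y, h]
  have hbij : Function.Bijective φ :=
    (Fintype.bijective_iff_injective_and_card φ).2 ⟨hinj, by simp [hF]⟩
  rw [Matrix.trace_pow_eq_sum_cycles, goldSum, ← hbij.sum_comp]
  refine Finset.sum_congr rfl fun x _ => ?_
  simp only [transferMatrix, Matrix.of_apply, ← bitSign_sum, Finset.sum_add_distrib]
  congr 1
  rw [map_add, one_mul]
  congr 1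
  · rw [pow_succ, mul_comm, ← frobenius_pow_apply, ← hg]
    have h1 : (g ^ u) (φ x) = ∑ i, x i • a (i + 1) := by
      simp only [φ, map_sum, map_smul]
      simp only [hg, frobenius_pow_apply, hshift]
    rw [h1, Finset.mul_sum, map_sum]
    refine Finset.sum_congr rfl fun i _ => ?_
    rw [mul_smul_comm, map_smul, hφj, smul_eq_mul]
  · simp [φ, htr]

end GoldSum

/-! ### Two-weight codes and the designs they hold -/

namespace BinaryCode

theorem ne_zero_iff_eq_one (a : ZMod 2) : a ≠ 0 ↔ a = 1 := by
  revert a; decide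

theorem supp_injective {n : ℕ} : Function.Injective (supp : (Fin n → ZMod 2) → Finset (Fin n)) := by
  intro a b h
  funext i
  have h1 : a i ≠ 0 ↔ b i ≠ 0 := by
    have := congrArg (i ∈ ·) h
    simpa [supp] using this
  generalize a i = x at h1
  generalize b i = y at h1
  revert x y; decide

/-- A binary word is determined by its support, so counting blocks amounts to counting codewords. -/
theorem holdsDesign_two_of_ncard {n : ℕ} (C : Submodule (ZMod 2) (Fin n → ZMod 2)) {v w l : ℕ}
    (hw : weightCount C w ≠ 0) (hv : n = v) (hw2 : 2 ≤ w)
    (h : ∀ i j, i ≠ j → {c | c ∈ C ∧ hammingNorm c = w ∧ c i ≠ 0 ∧ c j ≠ 0}.ncard = l) :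
    HoldsDesign C 2 v w l := by
  refine ⟨hw, by simpa using hv, by norm_num, hw2, ?_, ?_, ?_⟩
  · obtain ⟨c, -, hc⟩ := Set.nonempty_of_ncard_ne_zero hw
    rw [← hc, ← hv]
    simpa using hammingNorm_le_card_fintype (x := c)
  · rintro _ ⟨c, hc, rfl⟩
    exact hc.2
  · intro T hT
    obtain ⟨i, j, hij, rfl⟩ := Finset.card_eq_two.1 hT
    rw [← h i j hij, ← Set.ncard_image_of_injective _ supp_injective]
    congr 1
    ext b
    constructor
    · rintro ⟨⟨c, hc, rfl⟩, hT⟩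
      refine ⟨c, ⟨hc.1, hc.2, ?_, ?_⟩, rfl⟩
      · simpa [supp] using hT (show i ∈ ({i, j} : Finset _) by simp)
      · simpa [supp] using hT (show j ∈ ({i, j} : Finset _) by simp)
    · rintro ⟨c, ⟨h1, h2, h3, h4⟩, rfl⟩
      refine ⟨⟨c, ⟨h1, h2⟩, rfl⟩, ?_⟩
      intro k hk
      simp only [Finset.mem_insert, Finset.mem_singleton] at hk
      rcases hk with rfl | rfl <;> simpa [supp]

theorem sum_bitSign_eq {n : ℕ} (c : Fin n → ZMod 2) :
    ∑ i, bitSign (c i) = n - 2 * (hammingNorm c : ℤ) := by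
  have h (a : ZMod 2) : bitSign a = 1 - 2 * (if a ≠ 0 then 1 else 0) := by
    revert a; decide
  rw [Finset.sum_congr rfl fun i _ => h (c i), Finset.sum_sub_distrib, ← Finset.mul_sum,
    ← Finset.natCast_card_filter]
  simp [hammingNorm]

/-- Four times the indicator of both bits being nonzero is (1 - χ(x))(1 - χ(y)). -/
theorem four_mul_card_pair {V : Type*} {n : ℕ} (ev : V → Fin n → ZMod 2) (s : Finset V) (i j : Fin n) :
    4 * ((s.filter fun b => ev b i ≠ 0 ∧ ev b j ≠ 0).card : ℤ) =
      s.card - ∑ b ∈ s, bitSign (ev b i) - ∑ b ∈ s, bitSign (ev b j) +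
        ∑ b ∈ s, bitSign (ev b i) * bitSign (ev b j) := by
  have h1 (x y : ZMod 2) : 4 * (if x ≠ 0 ∧ y ≠ 0 then 1 else 0 : ℤ) =
      1 - bitSign x - bitSign y + bitSign x * bitSign y := by
    revert x y; decide
  rw [Finset.natCast_card_filter, Finset.mul_sum, Finset.sum_congr rfl fun b _ => h1 _ _,
    Finset.sum_add_distrib, Finset.sum_sub_distrib, Finset.sum_sub_distrib]
  simp

/-- A two-weight encoding, up to the zero word and the all-one word, in which distinct
coordinates are linearly independent. -/
structure IsTwoWeightEncoding {V : Type*} [AddCommGroup V] [Module (ZMod 2) V] [Fintype V] {n : ℕ}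
    (ev : V →ₗ[ZMod 2] (Fin n → ZMod 2)) (e : V) (w₁ w₂ : ℕ) : Prop where
  injective : Function.Injective ev
  map_e : ∀ i, ev e i = 1
  weight : ∀ b, b ≠ 0 → b ≠ e → hammingNorm (ev b) = w₁ ∨ hammingNorm (ev b) = w₂
  pos : 0 < w₁
  lt : w₁ < w₂
  add : w₁ + w₂ = n
  sum_coord : ∀ i, ∑ b, bitSign (ev b i) = 0
  sum_pair : ∀ i j, i ≠ j → ∑ b, bitSign (ev b i) * bitSign (ev b j) = 0

/-- The messages encoded by words of weight `w`. -/
def weightMessages {V : Type*} [AddCommGroup V] [Module (ZMod 2) V] [Fintype V] {n : ℕ}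
    (ev : V →ₗ[ZMod 2] (Fin n → ZMod 2)) (w : ℕ) : Finset V :=
  Finset.univ.filter fun b => hammingNorm (ev b) = w

namespace IsTwoWeightEncoding

variable {V : Type*} [AddCommGroup V] [Module (ZMod 2) V] [Fintype V] {n : ℕ}
  {ev : V →ₗ[ZMod 2] (Fin n → ZMod 2)} {e : V} {w₁ w₂ : ℕ}

theorem hammingNorm_e (h : IsTwoWeightEncoding ev e w₁ w₂) : hammingNorm (ev e) = n := by
  simp [hammingNorm, h.map_e]

theorem hammingNorm_add_e (h : IsTwoWeightEncoding ev e w₁ w₂) (b : V) :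
    (hammingNorm (ev (b + e)) : ℤ) = n - hammingNorm (ev b) := by
  have h1 := sum_bitSign_eq (ev (b + e))
  have h2 := sum_bitSign_eq (ev b)
  simp only [map_add, Pi.add_apply, bitSign_add, h.map_e, bitSign_one] at h1
  rw [← Finset.sum_mul] at h1
  simp only [map_add]
  linarith

theorem sum_weight_two (h : IsTwoWeightEncoding ev e w₁ w₂) {M : Type*} [AddCommMonoid M]
    (f : V → M) :
    ∑ b ∈ weightMessages ev w₂, f b = ∑ b ∈ weightMessages ev w₁, f (b + e) := by
  have h2 : e + e = 0 := by
    rw [← two_smul (ZMod 2) e]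
    exact zero_smul _ e
  have hadd := h.add
  refine Finset.sum_nbij' (fun b => b + e) (fun b => b + e) ?_ ?_ ?_ ?_ ?_
  · intro b hb
    have := h.hammingNorm_add_e b
    simp only [weightMessages, Finset.mem_filter, Finset.mem_univ, true_and] at hb ⊢
    omega
  · intro b hb
    have := h.hammingNorm_add_e b
    simp only [weightMessages, Finset.mem_filter, Finset.mem_univ, true_and] at hb ⊢
    omega
  · intro b _
    simp [add_assoc, h2]
  · intro b _
    simp [add_assoc, h2]
  · intro b _
    simp [add_assoc, h2]

/-- Adding e complements codewords, so the messages split into 0, e, those of weight w₁, and the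
translates of the latter by e. -/
theorem sum_eq (h : IsTwoWeightEncoding ev e w₁ w₂) {M : Type*} [AddCommMonoid M] (f : V → M) :
    ∑ b, f b = f 0 + f e + ∑ b ∈ weightMessages ev w₁, f b +
      ∑ b ∈ weightMessages ev w₁, f (b + e) := by
  classical
  rw [← h.sum_weight_two, weightMessages, weightMessages, Finset.sum_filter, Finset.sum_filter,
    ← Fintype.sum_ite_eq' 0 f, ← Fintype.sum_ite_eq' e f, ← Finset.sum_add_distrib,
    ← Finset.sum_add_distrib, ← Finset.sum_add_distrib]
  refine Finset.sum_congr rfl fun b _ => ?_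
  have hpos := h.pos
  have hlt := h.lt
  have hadd := h.add
  have he := h.hammingNorm_e
  have h0 : hammingNorm (ev 0) = 0 := by simp
  by_cases hb0 : b = 0
  · subst hb0
    have : (0 : V) ≠ e := by
      intro h1
      rw [← h1] at he
      omega
    rw [if_pos rfl, if_neg this, if_neg (by omega), if_neg (by omega)]
    simp
  · by_cases hbe : b = e
    · subst hbe
      rw [if_neg hb0, if_pos rfl, if_neg (by omega), if_neg (by omega)]
      simp
    · rw [if_neg hb0, if_neg hbe]
      rcases h.weight b hb0 hbe with h1 | h1
      · rw [if_pos h1, if_neg (by omega)]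
        simp
      · rw [if_neg (by omega), if_pos h1]
        simp

theorem card_eq (h : IsTwoWeightEncoding ev e w₁ w₂) :
    (Fintype.card V : ℤ) = 2 + 2 * (weightMessages ev w₁).card := by
  have h1 := h.sum_eq fun _ => (1 : ℤ)
  simp only [Finset.sum_const, Finset.card_univ, nsmul_eq_mul, mul_one] at h1
  linarith

theorem card_weight_two (h : IsTwoWeightEncoding ev e w₁ w₂) :
    (weightMessages ev w₂).card = (weightMessages ev w₁).card := by
  have h1 := h.sum_weight_two fun _ => 1
  simpa using h1

theorem bitSign_add_e (h : IsTwoWeightEncoding ev e w₁ w₂) (b : V) (i : Fin n) :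
    bitSign (ev (b + e) i) = -bitSign (ev b i) := by
  rw [map_add, Pi.add_apply, bitSign_add, h.map_e, bitSign_one, mul_neg_one]

/-- The product of two signs is unchanged by complementing, so orthogonality reads 0 = 1 + 1 + 2S.
-/
theorem sum_pair_weight_one (h : IsTwoWeightEncoding ev e w₁ w₂) {i j : Fin n} (hij : i ≠ j) :
    ∑ b ∈ weightMessages ev w₁, bitSign (ev b i) * bitSign (ev b j) = -1 := by
  have h1 := h.sum_eq fun b => bitSign (ev b i) * bitSign (ev b j)
  rw [h.sum_pair i j hij] at h1
  simp only [h.bitSign_add_e, neg_mul_neg, h.map_e, map_zero, Pi.zero_apply, bitSign_zero,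
    bitSign_one, mul_one] at h1
  linarith

/-- Evaluate ∑_b (∑_j χ_j(b)) χ_i(b) twice: orthogonality leaves only j = i, while the inner sum is
n - 2·weight, hence ±(w₂ - w₁) off 0 and e. The first moment is thus the same at every coordinate.
-/
theorem sum_coord_weight_one (h : IsTwoWeightEncoding ev e w₁ w₂) (i : Fin n) :
    2 * ((w₂ : ℤ) - w₁) * ∑ b ∈ weightMessages ev w₁, bitSign (ev b i) + 2 * n =
      Fintype.card V := by
  have hadd := h.add
  have h1 := h.sum_eq fun b => (∑ j, bitSign (ev b j)) * bitSign (ev b i)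
  have h2 : ∑ b, (∑ j, bitSign (ev b j)) * bitSign (ev b i) = Fintype.card V := by
    simp only [Finset.sum_mul]
    rw [Finset.sum_comm, Finset.sum_eq_single i]
    · simp [bitSign_mul_self]
    · intro j _ hj
      exact h.sum_pair j i hj
    · simp
  have h3 : ∑ b ∈ weightMessages ev w₁, (∑ j, bitSign (ev b j)) * bitSign (ev b i) =
      ((w₂ : ℤ) - w₁) * ∑ b ∈ weightMessages ev w₁, bitSign (ev b i) := by
    rw [Finset.mul_sum]
    refine Finset.sum_congr rfl fun b hb => ?_
    have hb1 : hammingNorm (ev b) = w₁ := by simpa [weightMessages] using hb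
    have hn : (n : ℤ) = w₁ + w₂ := by exact_mod_cast hadd.symm
    rw [sum_bitSign_eq, hb1, hn]
    ring
  simp only [h.bitSign_add_e, Finset.sum_neg_distrib, neg_mul_neg] at h1
  rw [h2, h3] at h1
  simp only [h.map_e, map_zero, Pi.zero_apply, bitSign_zero, bitSign_one, Finset.sum_const,
    Finset.card_univ, Fintype.card_fin, nsmul_eq_mul] at h1
  linarith

theorem ncard_range (h : IsTwoWeightEncoding ev e w₁ w₂) (P : (Fin n → ZMod 2) → Prop)
    [DecidablePred fun b => P (ev b)] (w : ℕ) :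
    {c | c ∈ LinearMap.range ev ∧ hammingNorm c = w ∧ P c}.ncard =
      ((weightMessages ev w).filter fun b => P (ev b)).card := by
  rw [← Set.ncard_coe_finset, ← Set.ncard_image_of_injective _ h.injective]
  congr 1
  ext c
  constructor
  · rintro ⟨⟨b, rfl⟩, h1, h2⟩
    exact ⟨b, by simp [weightMessages, h1, h2], rfl⟩
  · rintro ⟨b, hb, rfl⟩
    simp only [weightMessages, Finset.coe_filter, Set.mem_ofPred_eq, Finset.mem_filter,
      Finset.mem_univ, true_and] at hb
    exact ⟨⟨b, rfl⟩, hb⟩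

theorem weightCount_range (h : IsTwoWeightEncoding ev e w₁ w₂) (w : ℕ) :
    weightCount (LinearMap.range ev) w = (weightMessages ev w).card := by
  have h1 := h.ncard_range (fun _ => True) w
  simpa [weightCount] using h1

/-- The words of the smaller weight hold a `2`-design. -/
theorem holdsDesign_one (h : IsTwoWeightEncoding ev e w₁ w₂) {p : ℤ} {l : ℕ} (hw : 2 ≤ w₁)
    (hp : 2 * ((w₂ : ℤ) - w₁) * p + 2 * n = Fintype.card V)
    (hl : 4 * (l : ℤ) = (weightMessages ev w₁).card - 2 * p - 1)
    (hne : (weightMessages ev w₁).card ≠ 0) :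
    HoldsDesign (LinearMap.range ev) 2 n w₁ l := by
  have hlt := h.lt
  have hpi (i : Fin n) : ∑ b ∈ weightMessages ev w₁, bitSign (ev b i) = p := by
    have h1 := h.sum_coord_weight_one i
    have h2 : 2 * ((w₂ : ℤ) - w₁) ≠ 0 := by omega
    exact mul_left_cancel₀ h2 (by linarith)
  refine holdsDesign_two_of_ncard _ ?_ rfl hw fun i j hij => ?_
  · rwa [h.weightCount_range]
  · rw [h.ncard_range (fun c => c i ≠ 0 ∧ c j ≠ 0)]
    have h1 := four_mul_card_pair ev (weightMessages ev w₁) i j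
    rw [hpi, hpi, h.sum_pair_weight_one hij] at h1
    omega

/-- The words of the larger weight hold a `2`-design. -/
theorem holdsDesign_two (h : IsTwoWeightEncoding ev e w₁ w₂) {p : ℤ} {l : ℕ} (hw : 2 ≤ w₂)
    (hp : 2 * ((w₂ : ℤ) - w₁) * p + 2 * n = Fintype.card V)
    (hl : 4 * (l : ℤ) = (weightMessages ev w₁).card + 2 * p - 1)
    (hne : (weightMessages ev w₁).card ≠ 0) :
    HoldsDesign (LinearMap.range ev) 2 n w₂ l := by
  have hlt := h.lt
  have hpi (i : Fin n) : ∑ b ∈ weightMessages ev w₁, bitSign (ev b i) = p := by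
    have h1 := h.sum_coord_weight_one i
    have h2 : 2 * ((w₂ : ℤ) - w₁) ≠ 0 := by omega
    exact mul_left_cancel₀ h2 (by linarith)
  refine holdsDesign_two_of_ncard _ ?_ rfl hw fun i j hij => ?_
  · rwa [h.weightCount_range, h.card_weight_two]
  · rw [h.ncard_range (fun c => c i ≠ 0 ∧ c j ≠ 0)]
    have h1 := four_mul_card_pair ev (weightMessages ev w₂) i j
    simp only [h.sum_weight_two, h.bitSign_add_e, neg_mul_neg, Finset.sum_neg_distrib, hpi,
      h.sum_pair_weight_one hij, h.card_weight_two] at h1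
    omega

end IsTwoWeightEncoding

end BinaryCode

/-! ### MacWilliams identities and designs in the dual code -/

namespace BinaryCode

open Polynomial

theorem prod_one_add_bitSign_mul_X {n : ℕ} (c : Fin n → ZMod 2) :
    ∏ k, (1 + C (bitSign (c k)) * X : ℤ[X]) =
      (1 + X) ^ (n - hammingNorm c) * (1 - X) ^ hammingNorm c := by
  have h (k : Fin n) : (1 + C (bitSign (c k)) * X : ℤ[X]) = if c k = 0 then 1 + X else 1 - X := by
    by_cases hc : c k = 0
    · simp [hc, bitSign]
    · simp [hc, bitSign, sub_eq_add_neg]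
  have h2 := Finset.card_filter_add_card_filter_not (s := (Finset.univ : Finset (Fin n)))
    (fun i => c i ≠ 0)
  simp only [Finset.card_univ, Fintype.card_fin, not_not] at h2
  have h3 : hammingNorm c = (Finset.univ.filter fun i => c i ≠ 0).card := rfl
  rw [Finset.prod_congr rfl fun k _ => h k, Finset.prod_ite, Finset.prod_const, Finset.prod_const]
  congr 2
  omega

/-- The sum factors over coordinates; on T the choice `v k = 0`, which contributes the term 1, is
forbidden. -/
theorem sum_bitSign_dotProduct {n : ℕ} (c : Fin n → ZMod 2) (T : Finset (Fin n)) :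
    ∑ v : Fin n → ZMod 2 with ∀ k ∈ T, v k ≠ 0,
        (C (bitSign (v ⬝ᵥ c)) * X ^ hammingNorm v : ℤ[X]) =
      ∏ k, if k ∈ T then C (bitSign (c k)) * X else 1 + C (bitSign (c k)) * X := by
  let g : Fin n → ZMod 2 → ℤ[X] := fun k a =>
    if a = 0 then (if k ∈ T then 0 else 1) else C (bitSign (c k)) * X
  have h1 (k : Fin n) : (if k ∈ T then C (bitSign (c k)) * X else 1 + C (bitSign (c k)) * X) =
      ∑ a, g k a := by
    have : (Finset.univ : Finset (ZMod 2)) = {0, 1} := by decide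
    rw [this, Finset.sum_pair (by decide)]
    by_cases hk : k ∈ T <;> simp [g, hk]
  rw [Finset.prod_congr rfl fun k _ => h1 k, Finset.prod_univ_sum, Fintype.piFinset_univ,
    Finset.sum_filter]
  refine Finset.sum_congr rfl fun v _ => ?_
  by_cases hv : ∀ k ∈ T, v k ≠ 0
  · rw [if_pos hv, dotProduct, bitSign_sum, map_prod, hammingNorm, ← Finset.prod_const,
      Finset.prod_filter, ← Finset.prod_mul_distrib]
    refine Finset.prod_congr rfl fun k _ => ?_
    by_cases h0 : v k = 0
    · have : k ∉ T := fun hk => hv k hk h0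
      simp [g, h0, this, bitSign_zero]
    · have : v k = 1 := (ne_zero_iff_eq_one _).1 h0
      simp [g, this]
  · rw [if_neg hv]
    push Not at hv
    obtain ⟨k, hk, h0⟩ := hv
    exact (Finset.prod_eq_zero (Finset.mem_univ k) (by simp [g, h0, hk])).symm

open Classical in
/-- The weight enumerator of the words of the dual code that do not vanish on `T`. -/
noncomputable def dualEnumerator {n : ℕ} (C : Submodule (ZMod 2) (Fin n → ZMod 2))
    (T : Finset (Fin n)) : ℤ[X] :=
  ∑ v : Fin n → ZMod 2 with v ∈ dual C ∧ ∀ k ∈ T, v k ≠ 0, X ^ hammingNorm v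

theorem coeff_dualEnumerator {n : ℕ} (C : Submodule (ZMod 2) (Fin n → ZMod 2))
    (T : Finset (Fin n)) (w : ℕ) :
    (dualEnumerator C T).coeff w =
      {v | v ∈ dual C ∧ hammingNorm v = w ∧ ∀ k ∈ T, v k ≠ 0}.ncard := by
  classical
  rw [dualEnumerator, finsetSum_coeff]
  simp only [coeff_X_pow]
  rw [← Finset.natCast_card_filter, ← Set.ncard_coe_finset]
  congr 2
  ext v
  simp only [eq_comm (a := w), Finset.coe_filter, Finset.mem_filter, Finset.mem_univ, true_and,
    Set.mem_ofPred_eq]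
  tauto

theorem sum_bitSign_dual {V : Type*} [AddCommGroup V] [Module (ZMod 2) V] [Fintype V] {n : ℕ}
    (ev : V →ₗ[ZMod 2] (Fin n → ZMod 2)) (v : Fin n → ZMod 2) [Decidable (v ∈ dual (LinearMap.range ev))] :
    ∑ b, bitSign (v ⬝ᵥ ev b) = if v ∈ dual (LinearMap.range ev) then (Fintype.card V : ℤ) else 0 := by
  split_ifs with h
  · have h1 (b : V) : v ⬝ᵥ ev b = 0 := h _ ⟨b, rfl⟩
    simp [h1, bitSign_zero]
  · refine sum_bitSign_addMonoidHom
      { toFun := fun b => v ⬝ᵥ ev b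
        map_zero' := by simp
        map_add' := fun a b => by rw [map_add, dotProduct_add] } ?_
    by_contra! h1
    refine h ?_
    rintro _ ⟨b, rfl⟩
    exact h1 b

/-- By orthogonality, averaging χ(v · ev b) over b is the indicator of the dual code. -/
theorem card_mul_dualEnumerator {V : Type*} [AddCommGroup V] [Module (ZMod 2) V] [Fintype V]
    {n : ℕ} (ev : V →ₗ[ZMod 2] (Fin n → ZMod 2)) (T : Finset (Fin n)) :
    C (Fintype.card V : ℤ) * dualEnumerator (LinearMap.range ev) T =
      ∑ b, ∏ k, if k ∈ T then C (bitSign (ev b k)) * X else 1 + C (bitSign (ev b k)) * X := by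
  classical
  rw [Finset.sum_congr rfl fun b _ => (sum_bitSign_dotProduct (ev b) T).symm, Finset.sum_comm,
    dualEnumerator, Finset.mul_sum, ← Finset.filter_filter, Finset.filter_comm, Finset.sum_filter]
  refine Finset.sum_congr rfl fun v _ => ?_
  rw [← Finset.sum_mul, ← map_sum, sum_bitSign_dual]
  split_ifs <;> simp

/-- For a sign s, 1 - X² = (1 - sX)(1 + sX) and sX(1 - sX) = X(s - X). The multiplier restores the
missing factors at i and j, so the product depends on c only through its weight and its signs at i
and j. -/
theorem one_sub_sq_mul_prod {n : ℕ} (c : Fin n → ZMod 2) {i j : Fin n} (hij : i ≠ j) :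
    (1 - X ^ 2) ^ 2 * ∏ k, (if k ∈ ({i, j} : Finset (Fin n)) then C (bitSign (c k)) * X
        else 1 + C (bitSign (c k)) * X : ℤ[X]) =
      X ^ 2 * ((C (bitSign (c i)) - X) * (C (bitSign (c j)) - X) *
        ((1 + X) ^ (n - hammingNorm c) * (1 - X) ^ hammingNorm c)) := by
  have hsq (k : Fin n) : (C (bitSign (c k)) * C (bitSign (c k)) : ℤ[X]) = 1 := by
    rw [← C_mul, bitSign_mul_self, C_1]
  have hfac (k : Fin n) : (1 - X ^ 2 : ℤ[X]) =
      (1 - C (bitSign (c k)) * X) * (1 + C (bitSign (c k)) * X) := by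
    linear_combination X ^ 2 * hsq k
  have hsub (k : Fin n) : (C (bitSign (c k)) * X * (1 - C (bitSign (c k)) * X) : ℤ[X]) =
      X * (C (bitSign (c k)) - X) := by
    linear_combination -X ^ 2 * hsq k
  have hi : i ∈ (Finset.univ : Finset (Fin n)) := Finset.mem_univ i
  have hj : j ∈ Finset.univ.erase i := Finset.mem_erase.2 ⟨hij.symm, Finset.mem_univ j⟩
  rw [← prod_one_add_bitSign_mul_X, ← Finset.mul_prod_erase _ _ hi, ← Finset.mul_prod_erase _ _ hj,
    ← Finset.mul_prod_erase _ _ hi, ← Finset.mul_prod_erase _ _ hj, if_pos (by simp),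
    if_pos (by simp)]
  have hrest : ∏ k ∈ (Finset.univ.erase i).erase j, (if k ∈ ({i, j} : Finset (Fin n)) then
      C (bitSign (c k)) * X else 1 + C (bitSign (c k)) * X : ℤ[X]) =
      ∏ k ∈ (Finset.univ.erase i).erase j, (1 + C (bitSign (c k)) * X) := by
    refine Finset.prod_congr rfl fun k hk => if_neg ?_
    simp only [Finset.mem_erase, Finset.mem_insert, Finset.mem_singleton] at hk ⊢
    tauto
  rw [hrest]
  generalize ∏ k ∈ (Finset.univ.erase i).erase j, (1 + C (bitSign (c k)) * X : ℤ[X]) = R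
  calc _ = (1 - X ^ 2) * (1 - X ^ 2) * (C (bitSign (c i)) * X * (C (bitSign (c j)) * X * R)) := by
        ring
    _ = (C (bitSign (c i)) * X * (1 - C (bitSign (c i)) * X)) *
        (C (bitSign (c j)) * X * (1 - C (bitSign (c j)) * X)) *
        ((1 + C (bitSign (c i)) * X) * ((1 + C (bitSign (c j)) * X) * R)) := by
        nth_rewrite 1 [hfac i]
        rw [hfac j]
        ring
    _ = _ := by
        rw [hsub, hsub]
        ring

namespace IsTwoWeightEncoding

variable {V : Type*} [AddCommGroup V] [Module (ZMod 2) V] [Fintype V] {n : ℕ}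
  {ev : V →ₗ[ZMod 2] (Fin n → ZMod 2)} {e : V} {w₁ w₂ : ℕ}

theorem sum_mul_weights (h : IsTwoWeightEncoding ev e w₁ w₂) (f : V → ℤ[X]) :
    ∑ b, f b * ((1 + X) ^ (n - hammingNorm (ev b)) * (1 - X) ^ hammingNorm (ev b)) =
      f 0 * (1 + X) ^ n + f e * (1 - X) ^ n +
        (∑ b ∈ weightMessages ev w₁, f b) * ((1 + X) ^ w₂ * (1 - X) ^ w₁) +
        (∑ b ∈ weightMessages ev w₁, f (b + e)) * ((1 + X) ^ w₁ * (1 - X) ^ w₂) := by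
  have hadd := h.add
  have hA : ∀ b ∈ weightMessages ev w₁,
      f b * ((1 + X) ^ (n - hammingNorm (ev b)) * (1 - X) ^ hammingNorm (ev b)) =
        f b * ((1 + X) ^ w₂ * (1 - X) ^ w₁) := by
    intro b hb
    have hb1 : hammingNorm (ev b) = w₁ := by simpa [weightMessages] using hb
    rw [hb1, show n - w₁ = w₂ by omega]
  have hB : ∀ b ∈ weightMessages ev w₁,
      f (b + e) * ((1 + X) ^ (n - hammingNorm (ev (b + e))) * (1 - X) ^ hammingNorm (ev (b + e))) =
        f (b + e) * ((1 + X) ^ w₁ * (1 - X) ^ w₂) := by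
    intro b hb
    have hb1 : hammingNorm (ev b) = w₁ := by simpa [weightMessages] using hb
    have hb2 := h.hammingNorm_add_e b
    rw [show hammingNorm (ev (b + e)) = w₂ by omega, show n - w₂ = w₁ by omega]
  rw [h.sum_eq, Finset.sum_mul, Finset.sum_mul, Finset.sum_congr rfl hA, Finset.sum_congr rfl hB,
    h.hammingNorm_e, map_zero, hammingNorm_zero, Nat.sub_zero, Nat.sub_self, pow_zero, pow_zero,
    mul_one, one_mul]

/-- The MacWilliams identity for a two-weight encoding. -/
theorem card_mul_dualEnumerator_empty (h : IsTwoWeightEncoding ev e w₁ w₂) :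
    C (Fintype.card V : ℤ) * dualEnumerator (LinearMap.range ev) ∅ =
      (1 + X) ^ n + (1 - X) ^ n + C ((weightMessages ev w₁).card : ℤ) *
        ((1 + X) ^ w₂ * (1 - X) ^ w₁ + (1 + X) ^ w₁ * (1 - X) ^ w₂) := by
  have h1 := h.sum_mul_weights fun _ => 1
  rw [card_mul_dualEnumerator]
  simp only [Finset.notMem_empty, if_false, prod_one_add_bitSign_mul_X]
  simp only [one_mul, Finset.sum_const, nsmul_eq_mul, mul_one] at h1
  rw [h1, map_natCast]
  ring

/-- Summing (s_i - X)(s_j - X) over a weight class needs only the moments -1 and p; complementing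
changes the sign of p. The right side no longer involves i and j, which is what makes the dual words
a design. -/
theorem card_mul_dualEnumerator_pair (h : IsTwoWeightEncoding ev e w₁ w₂) {p : ℤ}
    (hp : 2 * ((w₂ : ℤ) - w₁) * p + 2 * n = Fintype.card V) {i j : Fin n} (hij : i ≠ j) :
    (1 - X ^ 2) ^ 2 * (C (Fintype.card V : ℤ) * dualEnumerator (LinearMap.range ev) {i, j}) =
      X ^ 2 * ((1 - X) ^ 2 * (1 + X) ^ n + (1 + X) ^ 2 * (1 - X) ^ n +
        (-1 - 2 * C p * X + C ((weightMessages ev w₁).card : ℤ) * X ^ 2) *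
          ((1 + X) ^ w₂ * (1 - X) ^ w₁) +
        (-1 + 2 * C p * X + C ((weightMessages ev w₁).card : ℤ) * X ^ 2) *
          ((1 + X) ^ w₁ * (1 - X) ^ w₂)) := by
  have hlt := h.lt
  have hpi (i : Fin n) : ∑ b ∈ weightMessages ev w₁, bitSign (ev b i) = p := by
    have h1 := h.sum_coord_weight_one i
    have h2 : 2 * ((w₂ : ℤ) - w₁) ≠ 0 := by omega
    exact mul_left_cancel₀ h2 (by linarith)
  have hexp (s : ℤ) (hs : s = 1 ∨ s = -1) : ∑ b ∈ weightMessages ev w₁,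
      (C (s * bitSign (ev b i)) - X) * (C (s * bitSign (ev b j)) - X) =
      -1 - 2 * C (s * p) * X + C ((weightMessages ev w₁).card : ℤ) * X ^ 2 := by
    have h3 (b : V) : ((C (s * bitSign (ev b i)) - X) * (C (s * bitSign (ev b j)) - X) : ℤ[X]) =
        C (bitSign (ev b i) * bitSign (ev b j)) -
          C s * (C (bitSign (ev b i)) + C (bitSign (ev b j))) * X + X ^ 2 := by
      have hs2 : (C s * C s : ℤ[X]) = 1 := by
        rcases hs with rfl | rfl <;> simp
      simp only [C_mul]
      linear_combination (C (bitSign (ev b i)) * C (bitSign (ev b j))) * hs2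
    rw [Finset.sum_congr rfl fun b _ => h3 b, Finset.sum_add_distrib, Finset.sum_sub_distrib,
      ← Finset.sum_mul, ← Finset.mul_sum, Finset.sum_add_distrib, ← map_sum, ← map_sum, ← map_sum,
      hpi, hpi, h.sum_pair_weight_one hij]
    simp only [Finset.sum_const, nsmul_eq_mul, C_mul, map_neg, map_one, map_natCast]
    ring
  have h1 := hexp 1 (by simp)
  have h2 := hexp (-1) (by simp)
  simp only [one_mul, neg_one_mul] at h1 h2
  rw [card_mul_dualEnumerator, Finset.mul_sum,
    Finset.sum_congr rfl fun b _ => one_sub_sq_mul_prod (ev b) hij, ← Finset.mul_sum,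
    h.sum_mul_weights fun b => (C (bitSign (ev b i)) - X) * (C (bitSign (ev b j)) - X)]
  simp only [h.bitSign_add_e]
  rw [h1, h2]
  simp only [map_zero, Pi.zero_apply, h.map_e, bitSign_zero, bitSign_one, map_neg, map_one]
  ring

theorem dualEnumerator_pair_eq (h : IsTwoWeightEncoding ev e w₁ w₂) {p : ℤ}
    (hp : 2 * ((w₂ : ℤ) - w₁) * p + 2 * n = Fintype.card V) {i j i' j' : Fin n} (hij : i ≠ j)
    (hij' : i' ≠ j') :
    dualEnumerator (LinearMap.range ev) {i, j} = dualEnumerator (LinearMap.range ev) {i', j'} := by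
  have h1 := (h.card_mul_dualEnumerator_pair hp hij).trans
    (h.card_mul_dualEnumerator_pair hp hij').symm
  have h2 : ((1 - X ^ 2) ^ 2 : ℤ[X]) ≠ 0 := by
    refine pow_ne_zero _ fun h0 => ?_
    have := congrArg (eval 0) h0
    simp at this
  have h3 : (C (Fintype.card V : ℤ) : ℤ[X]) ≠ 0 := by
    rw [Ne, C_eq_zero]
    exact_mod_cast Fintype.card_ne_zero (α := V)
  exact mul_left_cancel₀ h3 (mul_left_cancel₀ h2 h1)

/-- Double counting of words with ordered pairs in their support; with constant pair counts it
yields the value of λ. -/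
theorem sum_ncard_pair (D : Submodule (ZMod 2) (Fin n → ZMod 2)) (w : ℕ) :
    ∑ q ∈ (Finset.univ : Finset (Fin n)).offDiag,
        {v | v ∈ D ∧ hammingNorm v = w ∧ v q.1 ≠ 0 ∧ v q.2 ≠ 0}.ncard =
      weightCount D w * (w * w - w) := by
  classical
  let S : Finset (Fin n → ZMod 2) := Finset.univ.filter fun v => v ∈ D ∧ hammingNorm v = w
  have h1 (q : Fin n × Fin n) : {v | v ∈ D ∧ hammingNorm v = w ∧ v q.1 ≠ 0 ∧ v q.2 ≠ 0}.ncard =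
      (S.filter fun v => v q.1 ≠ 0 ∧ v q.2 ≠ 0).card := by
    rw [← Set.ncard_coe_finset]
    congr 1
    ext v
    simp [S, and_assoc]
  have h2 : weightCount D w = S.card := by
    rw [weightCount, ← Set.ncard_coe_finset]
    congr 1
    ext v
    simp [S]
  rw [Finset.sum_congr rfl fun q _ => h1 q, h2]
  simp only [Finset.card_filter]
  rw [Finset.sum_comm, Finset.sum_const_nat]
  intro v hv
  have hv1 : (supp v).card = w := (Finset.mem_filter.1 hv).2.2
  rw [← Finset.card_filter, ← hv1, ← Finset.offDiag_card]
  congr 1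
  ext q
  simp [supp]
  tauto

/-- The words of a fixed weight in the dual code hold a `2`-design. -/
theorem exists_holdsDesign_dual (h : IsTwoWeightEncoding ev e w₁ w₂) {p : ℤ}
    (hp : 2 * ((w₂ : ℤ) - w₁) * p + 2 * n = Fintype.card V) (hn : 2 ≤ n) {w : ℕ} (hw : 2 ≤ w)
    (hne : weightCount (dual (LinearMap.range ev)) w ≠ 0) :
    ∃ l : ℕ, (l : ℚ) = (w : ℚ) * (w - 1) * weightCount (dual (LinearMap.range ev)) w /
        ((n : ℚ) * (n - 1)) ∧
      HoldsDesign (dual (LinearMap.range ev)) 2 n w l := by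
  have hpair (i j : Fin n) : {v | v ∈ dual (LinearMap.range ev) ∧ hammingNorm v = w ∧
      v i ≠ 0 ∧ v j ≠ 0}.ncard = ((dualEnumerator (LinearMap.range ev) {i, j}).coeff w).toNat := by
    rw [coeff_dualEnumerator, Int.toNat_natCast]
    simp
  let i₀ : Fin n := ⟨0, by omega⟩
  let j₀ : Fin n := ⟨1, by omega⟩
  have h₀ : i₀ ≠ j₀ := by simp [i₀, j₀]
  set l := ((dualEnumerator (LinearMap.range ev) {i₀, j₀}).coeff w).toNat with hl
  have hconst (i j : Fin n) (hij : i ≠ j) : {v | v ∈ dual (LinearMap.range ev) ∧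
      hammingNorm v = w ∧ v i ≠ 0 ∧ v j ≠ 0}.ncard = l := by
    rw [hpair, h.dualEnumerator_pair_eq hp hij h₀]
  refine ⟨l, ?_, holdsDesign_two_of_ncard _ hne rfl hw hconst⟩
  have h1 := sum_ncard_pair (dual (LinearMap.range ev)) w
  rw [Finset.sum_congr rfl fun q hq => hconst q.1 q.2 (Finset.mem_offDiag.1 hq).2.2,
    Finset.sum_const, Finset.offDiag_card, Finset.card_univ, Fintype.card_fin, smul_eq_mul] at h1
  have h2 : ((n * n - n : ℕ) : ℚ) = n * (n - 1) := by
    rw [Nat.cast_sub (Nat.le_mul_self n)]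
    push_cast
    ring
  have h3 : ((w * w - w : ℕ) : ℚ) = w * (w - 1) := by
    rw [Nat.cast_sub (Nat.le_mul_self w)]
    push_cast
    ring
  have h4 : (n : ℚ) * (n - 1) ≠ 0 := by
    have : (2 : ℚ) ≤ n := by exact_mod_cast hn
    have h5 : (0 : ℚ) < n * (n - 1) := mul_pos (by linarith) (by linarith)
    exact h5.ne'
  have h5 := congrArg (Nat.cast : ℕ → ℚ) h1
  rw [Nat.cast_mul, Nat.cast_mul, h2, h3] at h5
  rw [eq_div_iff h4]
  linarith

end IsTwoWeightEncoding

theorem coeff_one_sub_X_pow (n k : ℕ) :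
    ((1 - X : ℤ[X]) ^ n).coeff k = (-1) ^ k * n.choose k := by
  have h : ((1 - X : ℤ[X]) ^ n) = ((1 + X) ^ n).comp (C (-1) * X) := by
    simp [sub_eq_add_neg]
  rw [h, comp_C_mul_X_coeff, coeff_one_add_X_pow, mul_comm]

theorem one_add_X_pow_add_one_sub_X_pow (n : ℕ) :
    ((1 + X) ^ n + (1 - X) ^ n : ℤ[X]) =
      expand ℤ 2 (∑ j ∈ Finset.range (n + 1), C (2 * (n.choose (2 * j) : ℤ)) * X ^ j) := by
  ext k
  rw [coeff_add, coeff_one_add_X_pow, coeff_one_sub_X_pow, coeff_expand (by norm_num)]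
  rcases Nat.even_or_odd k with hk | hk
  · rw [if_pos hk.two_dvd, hk.neg_one_pow, finsetSum_coeff]
    simp only [coeff_C_mul, coeff_X_pow, mul_ite, mul_one, mul_zero]
    rw [Finset.sum_ite_eq, Nat.mul_div_cancel' hk.two_dvd]
    split_ifs with h
    · ring
    · rw [Nat.choose_eq_zero_of_lt (by simp at h; omega)]
      simp
  · rw [if_neg (by rw [← even_iff_two_dvd]; exact Nat.not_even_iff_odd.2 hk), hk.neg_one_pow]
    ring

/-- The polynomial is (1 - X²)^a ((1 + X)^d + (1 - X)^d), a polynomial in X², so the coefficient is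
a convolution over i + j = r. -/
theorem coeff_two_weight_enumerator (a d r : ℕ) :
    ((1 + X : ℤ[X]) ^ (a + d) * (1 - X) ^ a + (1 + X) ^ a * (1 - X) ^ (a + d)).coeff (2 * r) =
      2 * ∑ q ∈ Finset.HasAntidiagonal.antidiagonal r,
        (-1) ^ q.1 * (a.choose q.1 : ℤ) * (d.choose (2 * q.2) : ℤ) := by
  have h1 : ((1 + X : ℤ[X]) ^ (a + d) * (1 - X) ^ a + (1 + X) ^ a * (1 - X) ^ (a + d)) =
      expand ℤ 2 ((1 - X) ^ a *
        ∑ j ∈ Finset.range (d + 1), C (2 * (d.choose (2 * j) : ℤ)) * X ^ j) := by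
    rw [map_mul, ← one_add_X_pow_add_one_sub_X_pow, map_pow, map_sub, map_one, expand_X,
      show (1 - X ^ 2 : ℤ[X]) = (1 + X) * (1 - X) by ring, mul_pow]
    ring
  rw [h1, mul_comm 2 r, coeff_expand_mul (by norm_num), coeff_mul, Finset.mul_sum]
  refine Finset.sum_congr rfl fun q _ => ?_
  rw [coeff_one_sub_X_pow, finsetSum_coeff]
  simp only [coeff_C_mul, coeff_X_pow, mul_ite, mul_one, mul_zero]
  rw [Finset.sum_ite_eq]
  split_ifs with h
  · ring
  · rw [Nat.choose_eq_zero_of_lt (n := d) (by simp at h; omega)]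
    simp

namespace IsTwoWeightEncoding

variable {V : Type*} [AddCommGroup V] [Module (ZMod 2) V] [Fintype V] {n : ℕ}
  {ev : V →ₗ[ZMod 2] (Fin n → ZMod 2)} {e : V} {w₁ w₂ : ℕ}

/-- The even part of the weight distribution of the dual of a two-weight encoding. -/
theorem card_mul_weightCount_dual (h : IsTwoWeightEncoding ev e w₁ w₂) (r : ℕ) :
    (Fintype.card V : ℤ) * weightCount (dual (LinearMap.range ev)) (2 * r) =
      2 * (n.choose (2 * r) + (weightMessages ev w₁).card *
        ∑ q ∈ Finset.HasAntidiagonal.antidiagonal r,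
          (-1) ^ q.1 * (w₁.choose q.1 : ℤ) * ((w₂ - w₁).choose (2 * q.2) : ℤ)) := by
  have h1 := congrArg (fun f => coeff f (2 * r)) h.card_mul_dualEnumerator_empty
  have hw : w₂ = w₁ + (w₂ - w₁) := by have := h.lt; omega
  have h2 := coeff_two_weight_enumerator w₁ (w₂ - w₁) r
  rw [← hw] at h2
  simp only [coeff_C_mul, coeff_add, coeff_dualEnumerator, coeff_one_add_X_pow,
    coeff_one_sub_X_pow] at h1
  rw [← coeff_add, h2, (even_two_mul r).neg_one_pow] at h1
  simp only [Finset.notMem_empty, IsEmpty.forall_iff, implies_true, and_true] at h1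
  rw [weightCount, h1]
  ring

end IsTwoWeightEncoding

end BinaryCode

/-! ### The code of the defining set -/

namespace BinaryCode

variable {F : Type*} [Field F] [Fintype F] [Algebra (ZMod 2) F]

/-- The encoder of the code of a defining set. -/
noncomputable def definingSetEncoder {n : ℕ} (d : Fin n → F) : F →ₗ[ZMod 2] (Fin n → ZMod 2) :=
  LinearMap.pi fun i => (Algebra.trace (ZMod 2) F).comp (LinearMap.mulRight (ZMod 2) (d i))

omit [Fintype F] in
theorem definingSetEncoder_apply {n : ℕ} (d : Fin n → F) (b : F) (i : Fin n) :
    definingSetEncoder d b i = Algebra.trace (ZMod 2) F (b * d i) := rfl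

/-- Four times the indicator of the defining set is (1 - χ(Tr x))(1 + χ(ρ)χ(Tr x^(2^u+1))); the
factor χ(Tr x) shifts b to b + 1. -/
theorem four_mul_sum_bitSign_definingSet {n u : ℕ} {ρ : ZMod 2} {d : Fin n → F}
    (hd : Function.Injective d) (hD : Set.range d = definingSet F u ρ) (b : F) :
    4 * ∑ i, bitSign (Algebra.trace (ZMod 2) F (b * d i)) =
      ∑ x, bitSign (Algebra.trace (ZMod 2) F (b * x)) -
        ∑ x, bitSign (Algebra.trace (ZMod 2) F ((b + 1) * x)) +
        bitSign ρ * (goldSum F u b - goldSum F u (b + 1)) := by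
  classical
  have h1 : ∑ i, bitSign (Algebra.trace (ZMod 2) F (b * d i)) =
      ∑ x : F with x ∈ definingSet F u ρ, bitSign (Algebra.trace (ZMod 2) F (b * x)) := by
    rw [← Finset.sum_image (f := fun x => bitSign (Algebra.trace (ZMod 2) F (b * x))) hd.injOn]
    refine Finset.sum_congr ?_ fun _ _ => rfl
    ext x
    simp [← hD]
  have h2 (s t r : ZMod 2) : (if s = 1 ∧ t = r then 4 else 0 : ℤ) =
      (1 - bitSign s) * (1 + bitSign r * bitSign t) := by
    revert s t r; decide
  have h3 (x : F) : (4 * if x ∈ definingSet F u ρ then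
      bitSign (Algebra.trace (ZMod 2) F (b * x)) else 0) =
      bitSign (Algebra.trace (ZMod 2) F (b * x)) -
        bitSign (Algebra.trace (ZMod 2) F ((b + 1) * x)) +
        bitSign ρ * (bitSign (Algebra.trace (ZMod 2) F (x ^ (2 ^ u + 1) + b * x)) -
          bitSign (Algebra.trace (ZMod 2) F (x ^ (2 ^ u + 1) + (b + 1) * x))) := by
    have h4 := h2 (Algebra.trace (ZMod 2) F x) (Algebra.trace (ZMod 2) F (x ^ (2 ^ u + 1))) ρ
    have h5 : (4 * if x ∈ definingSet F u ρ then
        bitSign (Algebra.trace (ZMod 2) F (b * x)) else 0) =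
        (if Algebra.trace (ZMod 2) F x = 1 ∧ Algebra.trace (ZMod 2) F (x ^ (2 ^ u + 1)) = ρ
          then 4 else 0) * bitSign (Algebra.trace (ZMod 2) F (b * x)) := by
      by_cases hx : Algebra.trace (ZMod 2) F x = 1 ∧ Algebra.trace (ZMod 2) F (x ^ (2 ^ u + 1)) = ρ
      · rw [if_pos hx, if_pos (show x ∈ definingSet F u ρ from hx)]
      · rw [if_neg hx, if_neg (show x ∉ definingSet F u ρ from hx)]
        simp
    rw [h5, h4]
    simp only [add_mul, one_mul, map_add, bitSign_add]
    ring
  rw [h1, Finset.sum_filter, Finset.mul_sum, Finset.sum_congr rfl fun x _ => h3 x,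
    Finset.sum_add_distrib, Finset.sum_sub_distrib, ← Finset.mul_sum, Finset.sum_sub_distrib]
  rfl

theorem goldSum_cases {m u k : ℕ} (hm : m = 2 * k + 5) (hF : Fintype.card F = 2 ^ m)
    (hum : Nat.gcd u m = 1) (b : F) :
    (Algebra.trace (ZMod 2) F b = 0 ∧ goldSum F u b = 0) ∨
      (Algebra.trace (ZMod 2) F b = 1 ∧ (goldSum F u b = 8 * 2 ^ k ∨ goldSum F u b = -(8 * 2 ^ k))) := by
  have h := goldSum_sq (by omega) ⟨k + 2, by omega⟩ hF hum b
  by_cases hb : Algebra.trace (ZMod 2) F b = 0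
  · left
    rw [hb, bitSign_zero, sub_self, mul_zero] at h
    exact ⟨hb, pow_eq_zero_iff two_ne_zero |>.1 h⟩
  · right
    have hb1 := (ne_zero_iff_eq_one _).1 hb
    refine ⟨hb1, sq_eq_sq_iff_eq_or_eq_neg.1 ?_⟩
    rw [h, hb1, bitSign_one, hm, pow_add, pow_mul']
    ring

theorem goldSum_one_eq {m u k : ℕ} (hm : m = 2 * k + 5) (hF : Fintype.card F = 2 ^ m)
    (hum : Nat.gcd u m = 1) {ρ : ZMod 2}
    (hρ : (Even ((m ^ 2 - 1) / 8) ∧ ρ = 0) ∨ (Odd ((m ^ 2 - 1) / 8) ∧ ρ = 1)) :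
    goldSum F u 1 = bitSign ρ * (8 * 2 ^ k) := by
  have hodd : Odd m := ⟨k + 2, by omega⟩
  rw [goldSum_one hodd hF hum, trace_transferMatrix_pow m hodd (bitSign ρ),
    show (m + 1) / 2 = k + 3 by omega, pow_add]
  · ring
  · rcases hρ with ⟨h, rfl⟩ | ⟨h, rfl⟩
    · exact Or.inl ⟨h, rfl⟩
    · exact Or.inr ⟨h, rfl⟩

/-- The case b = 0 of the character sum: 4n = 2^m - χ(ρ)W(1), and the choice of ρ makes χ(ρ)W(1)
positive. -/
theorem length_definingSet {m u k n : ℕ} (hm : m = 2 * k + 5) (hF : Fintype.card F = 2 ^ m)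
    (hum : Nat.gcd u m = 1) {ρ : ZMod 2}
    (hρ : (Even ((m ^ 2 - 1) / 8) ∧ ρ = 0) ∨ (Odd ((m ^ 2 - 1) / 8) ∧ ρ = 1))
    {d : Fin n → F} (hd : Function.Injective d) (hD : Set.range d = definingSet F u ρ) :
    n + 2 * 2 ^ k = 8 * (2 ^ k * 2 ^ k) := by
  have h := four_mul_sum_bitSign_definingSet hd hD 0
  have h0 : goldSum F u 0 = 0 := by
    rcases goldSum_cases hm hF hum (0 : F) with h | h
    · exact h.2
    · exact absurd h.1 (by simp)
  simp only [zero_mul, map_zero, bitSign_zero, zero_add, sum_bitSign_trace (one_ne_zero (α := F)),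
    h0, goldSum_one_eq hm hF hum hρ, Finset.sum_const, Finset.card_univ, Fintype.card_fin,
    nsmul_eq_mul, mul_one, hF] at h
  have h1 := bitSign_mul_self ρ
  have h2 : ((2 ^ m : ℕ) : ℤ) = 32 * (2 ^ k * 2 ^ k) := by
    rw [hm]
    push_cast
    ring
  rw [h2] at h
  zify
  have h3 : 4 * ((n : ℤ) + 2 * 2 ^ k) = 4 * (8 * (2 ^ k * 2 ^ k)) := by
    linear_combination h - 8 * 2 ^ k * h1
  linarith

theorem isTwoWeightEncoding_definingSet {m u k n : ℕ} (hm : m = 2 * k + 5)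
    (hF : Fintype.card F = 2 ^ m) (hum : Nat.gcd u m = 1) {ρ : ZMod 2}
    (hρ : (Even ((m ^ 2 - 1) / 8) ∧ ρ = 0) ∨ (Odd ((m ^ 2 - 1) / 8) ∧ ρ = 1))
    {d : Fin n → F} (hd : Function.Injective d) (hD : Set.range d = definingSet F u ρ) :
    IsTwoWeightEncoding (definingSetEncoder d) 1 (4 * (2 ^ k * 2 ^ k) - 2 * 2 ^ k)
      (4 * (2 ^ k * 2 ^ k)) := by
  have hodd : Odd m := ⟨k + 2, by omega⟩
  have := charP_two_of_algebra F
  have hlen := length_definingSet hm hF hum hρ hd hD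
  have hq : 1 ≤ 2 ^ k := Nat.one_le_two_pow
  have hqq : 2 ^ k ≤ 2 ^ k * 2 ^ k := Nat.le_mul_self _
  have hone : ∀ i, definingSetEncoder d 1 i = 1 := fun i => by
    have h : d i ∈ definingSet F u ρ := hD ▸ Set.mem_range_self i
    rw [definingSetEncoder_apply, one_mul]
    exact h.1
  have hweight : ∀ b : F, b ≠ 0 → b ≠ 1 →
      hammingNorm (definingSetEncoder d b) = 4 * (2 ^ k * 2 ^ k) - 2 * 2 ^ k ∨
        hammingNorm (definingSetEncoder d b) = 4 * (2 ^ k * 2 ^ k) := by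
    intro b hb0 hb1
    have h1 := four_mul_sum_bitSign_definingSet hd hD b
    have hb2 : b + 1 ≠ 0 := fun h => hb1 (CharTwo.add_eq_zero.1 h)
    rw [sum_bitSign_trace hb0, sum_bitSign_trace hb2] at h1
    have h2 := sum_bitSign_eq (definingSetEncoder d b)
    simp only [definingSetEncoder_apply] at h2
    rw [h2] at h1
    have h3 : Algebra.trace (ZMod 2) F (b + 1) = Algebra.trace (ZMod 2) F b + 1 := by
      rw [map_add, trace_one_of_card hodd hF]
    have h4 : bitSign ρ = 1 ∨ bitSign ρ = -1 := by
      unfold bitSign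
      split_ifs <;> simp
    have h5 : ((2 : ℤ) ^ k) = ((2 ^ k : ℕ) : ℤ) := by push_cast; rfl
    change hammingNorm (fun i => Algebra.trace (ZMod 2) F (b * d i)) = _ ∨
      hammingNorm (fun i => Algebra.trace (ZMod 2) F (b * d i)) = _
    have h6 : hammingNorm (definingSetEncoder d b) =
      hammingNorm (fun i => Algebra.trace (ZMod 2) F (b * d i)) := rfl
    rw [h6] at h1
    generalize hammingNorm (fun i => Algebra.trace (ZMod 2) F (b * d i)) = w at *
    -- As Tr 1 = 1, exactly one of b and b + 1 has trace 1, so exactly one term is nonzero.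
    have hdiff : goldSum F u b - goldSum F u (b + 1) = 8 * 2 ^ k ∨
        goldSum F u b - goldSum F u (b + 1) = -(8 * 2 ^ k) := by
      rcases goldSum_cases hm hF hum b with ⟨ht, hg⟩ | ⟨ht, hg⟩ <;>
        rcases goldSum_cases hm hF hum (b + 1) with ⟨ht', hg'⟩ | ⟨ht', hg'⟩
      · rw [h3, ht] at ht'
        exact absurd ht' (by decide)
      · rw [hg]
        rcases hg' with hg' | hg' <;> rw [hg'] <;> simp
      · rw [hg']
        rcases hg with hg | hg <;> rw [hg] <;> simp
      · rw [h3, ht] at ht'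
        exact absurd ht' (by decide)
    have h7 : bitSign ρ * (goldSum F u b - goldSum F u (b + 1)) = 8 * 2 ^ k ∨
        bitSign ρ * (goldSum F u b - goldSum F u (b + 1)) = -(8 * 2 ^ k) := by
      rcases h4 with h4 | h4 <;> rcases hdiff with h | h <;> rw [h4, h] <;> simp
    rw [h5] at h7
    generalize 2 ^ k * 2 ^ k = Q at *
    generalize 2 ^ k = q at *
    omega
  refine ⟨?_, hone, hweight, by omega, by omega, by omega, ?_, ?_⟩
  · rw [injective_iff_map_eq_zero]
    intro b hb
    by_contra hb0
    by_cases hb1 : b = 1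
    · have h1 := congrFun hb ⟨0, by omega⟩
      rw [hb1, hone] at h1
      exact one_ne_zero h1
    · have h1 := hweight b hb0 hb1
      rw [hb, hammingNorm_zero] at h1
      omega
  · intro i
    have h0 : d i ≠ 0 := fun h => by
      have h1 := hone i
      rw [definingSetEncoder_apply, h, mul_zero, map_zero] at h1
      exact zero_ne_one h1
    simp only [definingSetEncoder_apply, mul_comm _ (d i)]
    exact sum_bitSign_trace h0
  · intro i j hij
    have h0 : d i + d j ≠ 0 := fun h => hij (hd (CharTwo.add_eq_zero.1 h))
    simp only [definingSetEncoder_apply, ← bitSign_add, ← map_add, ← mul_add,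
      mul_comm _ (d i + d j)]
    exact sum_bitSign_trace h0

end BinaryCode

/-! ### Assembly of the parameters -/

theorem mainTheorem5 {F : Type*} [Field F] [Fintype F] [Algebra (ZMod 2) F]
    (m : ℕ) (hm : 5 ≤ m) (hodd : Odd m) (hF : Fintype.card F = 2 ^ m)
    (u : ℕ) (hu : 0 < u) (hum : Nat.gcd u m = 1)
    (ρ : ZMod 2)
    (hρ : (Even ((m ^ 2 - 1) / 8) ∧ ρ = 0) ∨ (Odd ((m ^ 2 - 1) / 8) ∧ ρ = 1))
    -- an arbitrary enumeration of the points of the defining set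
    (n : ℕ) (d : Fin n → F) (hd : Function.Injective d)
    (hD : Set.range d = BinaryCode.definingSet F u ρ) :
    -- (1)
    BinaryCode.HoldsDesign (BinaryCode.definingSetCode d) 2
      (2 ^ (m - 2) - 2 ^ ((m - 3) / 2))
      (2 ^ (m - 3) - 2 ^ ((m - 3) / 2))
      (2 ^ (m - 3) - 2 ^ ((m - 3) / 2) - 1) ∧
    BinaryCode.HoldsDesign (BinaryCode.definingSetCode d) 2
      (2 ^ (m - 2) - 2 ^ ((m - 3) / 2))
      (2 ^ (m - 3))
      (2 ^ ((m - 3) / 2) * (2 ^ ((m - 3) / 2) + 1)) ∧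
    -- (2)
    ∀ r : ℕ, 2 ≤ r → r ≤ 2 ^ (m - 3) - 2 ^ ((m - 5) / 2) →
      (BinaryCode.weightCount (BinaryCode.dual (BinaryCode.definingSetCode d)) (2 * r) : ℚ) =
        ((2 : ℚ) ^ (m - 1))⁻¹ *
          (((2 ^ (m - 2) - 2 ^ ((m - 3) / 2)).choose (2 * r) : ℚ) +
            ((2 : ℚ) ^ (m - 1) - 1) *
              ∑ p ∈ (Finset.HasAntidiagonal.antidiagonal r).filter
                  (fun p : ℕ × ℕ => p.1 ≤ 2 ^ (m - 3) - 2 ^ ((m - 3) / 2) ∧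
                    p.2 ≤ 2 ^ ((m - 5) / 2)),
                (-1 : ℚ) ^ p.1 * ((2 ^ (m - 3) - 2 ^ ((m - 3) / 2)).choose p.1 : ℚ) *
                  ((2 ^ ((m - 3) / 2)).choose (2 * p.2) : ℚ)) ∧
      (0 < BinaryCode.weightCount (BinaryCode.dual (BinaryCode.definingSetCode d)) (2 * r) →
        ∃ l : ℕ,
          (l : ℚ) =
            (2 * r : ℚ) * (2 * r - 1) *
                (BinaryCode.weightCount
                  (BinaryCode.dual (BinaryCode.definingSetCode d)) (2 * r) : ℚ) /
              (((2 : ℚ) ^ (m - 2) - 2 ^ ((m - 3) / 2)) *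
                ((2 : ℚ) ^ (m - 2) - 2 ^ ((m - 3) / 2) - 1)) ∧
          BinaryCode.HoldsDesign (BinaryCode.dual (BinaryCode.definingSetCode d)) 2
            (2 ^ (m - 2) - 2 ^ ((m - 3) / 2)) (2 * r) l) := by
  obtain ⟨k, rfl⟩ : ∃ k, m = 2 * k + 5 := by
    obtain ⟨j, rfl⟩ := hodd
    exact ⟨j - 2, by omega⟩
  have h := BinaryCode.isTwoWeightEncoding_definingSet rfl hF hum hρ hd hD
  have hlen := BinaryCode.length_definingSet rfl hF hum hρ hd hD
  have hcode : BinaryCode.definingSetCode d =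
      LinearMap.range (BinaryCode.definingSetEncoder d) := rfl
  have hq : 1 ≤ 2 ^ k := Nat.one_le_two_pow
  have hqq : 2 ^ k ≤ 2 ^ k * 2 ^ k := Nat.le_mul_self _
  have e1 : 2 ^ (2 * k + 5 - 2) = 8 * (2 ^ k * 2 ^ k) := by
    rw [show 2 * k + 5 - 2 = k + k + 3 by omega]
    ring
  have e2 : 2 ^ ((2 * k + 5 - 3) / 2) = 2 * 2 ^ k := by
    rw [show (2 * k + 5 - 3) / 2 = k + 1 by omega]
    ring
  have e3 : 2 ^ (2 * k + 5 - 3) = 4 * (2 ^ k * 2 ^ k) := by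
    rw [show 2 * k + 5 - 3 = k + k + 2 by omega]
    ring
  have e4 : (2 * k + 5 - 5) / 2 = k := by omega
  have e5 : (2 : ℚ) ^ (2 * k + 5 - 1) = 16 * (2 ^ k * 2 ^ k) := by
    rw [show 2 * k + 5 - 1 = k + k + 4 by omega]
    ring
  have e6 : (2 : ℚ) ^ (2 * k + 5 - 2) - 2 ^ ((2 * k + 5 - 3) / 2) = n := by
    have h1 : (n : ℚ) + 2 * 2 ^ k = 8 * (2 ^ k * 2 ^ k) := by exact_mod_cast hlen
    have h2 : (2 : ℚ) ^ (2 * k + 5 - 2) = 8 * (2 ^ k * 2 ^ k) := by exact_mod_cast e1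
    have h3 : (2 : ℚ) ^ ((2 * k + 5 - 3) / 2) = 2 * 2 ^ k := by exact_mod_cast e2
    rw [h2, h3]
    linarith
  have hn : 2 ^ (2 * k + 5 - 2) - 2 ^ ((2 * k + 5 - 3) / 2) = n := by
    rw [e1, e2]
    omega
  have hcardV : (Fintype.card F : ℤ) = 32 * ((2 ^ k * 2 ^ k : ℕ) : ℤ) := by
    rw [hF]
    push_cast
    ring
  have hA := h.card_eq
  -- The first moment is p = 4·2^k + 1, solved from `sum_coord_weight_one` with w₂ - w₁ = 2·2^k.
  have hp : 2 * (((4 * (2 ^ k * 2 ^ k) : ℕ) : ℤ) - ((4 * (2 ^ k * 2 ^ k) - 2 * 2 ^ k : ℕ) : ℤ)) *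
      (4 * 2 ^ k + 1) + 2 * n = Fintype.card F := by
    have h1 : (n : ℤ) + 2 * 2 ^ k = 8 * (2 ^ k * 2 ^ k) := by exact_mod_cast hlen
    rw [hcardV, Nat.cast_sub (by omega)]
    push_cast
    linear_combination 2 * h1
  rw [hn, e6, e2, e3, e4, e5, hcode]
  refine ⟨?_, ?_, ?_⟩
  · refine h.holdsDesign_one (by omega) hp ?_ (by omega)
    generalize (BinaryCode.weightMessages (BinaryCode.definingSetEncoder d)
      (4 * (2 ^ k * 2 ^ k) - 2 * 2 ^ k)).card = A at *
    have h5 : ((2 : ℤ) ^ k) = ((2 ^ k : ℕ) : ℤ) := by push_cast; rfl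
    rw [h5]
    generalize 2 ^ k * 2 ^ k = Q at *
    omega
  · refine h.holdsDesign_two (by omega) hp ?_ (by omega)
    have h5 : ((2 : ℤ) ^ k) = ((2 ^ k : ℕ) : ℤ) := by push_cast; rfl
    rw [h5, show 2 * 2 ^ k * (2 * 2 ^ k + 1) = 4 * (2 ^ k * 2 ^ k) + 2 * 2 ^ k by ring]
    generalize (BinaryCode.weightMessages (BinaryCode.definingSetEncoder d)
      (4 * (2 ^ k * 2 ^ k) - 2 * 2 ^ k)).card = A at *
    generalize 2 ^ k * 2 ^ k = Q at *
    omega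
  · intro r hr _
    refine ⟨?_, fun hpos => ?_⟩
    · have h1 := h.card_mul_weightCount_dual r
      have h2 : 4 * (2 ^ k * 2 ^ k) - (4 * (2 ^ k * 2 ^ k) - 2 * 2 ^ k) = 2 * 2 ^ k := by omega
      rw [h2] at h1
      have h3 : (Fintype.card F : ℚ) = 32 * (2 ^ k * 2 ^ k) := by exact_mod_cast hcardV
      have h4 : ((BinaryCode.weightMessages (BinaryCode.definingSetEncoder d)
          (4 * (2 ^ k * 2 ^ k) - 2 * 2 ^ k)).card : ℚ) = 16 * (2 ^ k * 2 ^ k) - 1 := by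
        have h5 := congrArg (Int.cast : ℤ → ℚ) hA
        push_cast at h5
        rw [h3] at h5
        linarith
      have h6 := congrArg (Int.cast : ℤ → ℚ) h1
      push_cast at h6
      rw [h3, h4] at h6
      -- The bounds on i and j only discard terms whose binomial coefficient vanishes.
      rw [Finset.sum_filter_of_ne]
      · rw [eq_inv_mul_iff_mul_eq₀ (by positivity)]
        linarith
      · intro p _ hp
        by_contra hlt
        apply hp
        rw [not_and_or, not_le, not_le] at hlt
        rcases hlt with hlt | hlt
        · rw [Nat.choose_eq_zero_of_lt hlt]
          simp
        · rw [Nat.choose_eq_zero_of_lt (show 2 * 2 ^ k < 2 * p.2 by omega)]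
          simp
    · obtain ⟨l, hl, hdes⟩ := h.exists_holdsDesign_dual hp (by omega) (w := 2 * r) (by omega) hpos.ne'
      refine ⟨l, ?_, hdes⟩
      rw [hl]
      push_cast
      ring
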